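/- **Theorem.** Let $n\ge 2$. The bordification $\widehat X_n$ of Outer space equivariantly deformation retracts onto $\widehat Y_n$: there is a continuous map $\phi\colon \widehat X_n\times[0,1]\to\widehat X_n$ with $\phi(x,0)=x$ and $\phi(x,1)\in\widehat Y_n$ for all $x\in\widehat X_n$, with $\phi(y,t)=y$ for all $y\in\widehat Y_n$ and all $t$, and with $\phi(gx,t)=g\,\phi(x,t)$ for all $g\in \mathrm{Out}(F_n)$, $x$ and $t$. Moreover, under this retraction, the image $\widehat Z_n=\phi(\partial\widehat X_n\times\{1\})$ of $\partial\widehat X_n$ is the union of $\partial\widehat Y_n$ with the set of graphs in the interior $Y_n$ which have a cut vertex. Here the objects are the following. * Graphs are finite, and loops and multiple edges are allowed. A *marked graph* $\Gamma$ of rank $n$ is a connected graph with all vertices of valence at least $3$, together with a homotopy equivalence (marking) between the rose with fundamental group $F_n$ and $\Gamma$. Markings are taken up to homotopy, and $\mathrm{Out}(F_n)$ acts by changing the marking. A *core subgraph* of a graph is a (not necessarily connected) nonempty subgraph with no separating edges and no vertices of valence $0$ or $1$. * A point of $\widehat X_n$ is a marked graph $\Gamma_0$ of rank $n$ with a properly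 nested (possibly empty) sequence $\Gamma_1\supset\dots\supset\Gamma_k$ of core subgraphs of $\Gamma_0$, where each $\Gamma_i$ ($0\le i\le k$) carries a metric $m_i$, that is, an assignment of lengths $\ge 0$ to its edges, of total volume $1$. For $i\geq 1$, $\Gamma_i$ is the subgraph of $\Gamma_{i-1}$ spanned by the edges of length $0$, and every edge of $\Gamma_0$ has nonzero length in exactly one $\Gamma_i$. Points are taken up to isomorphisms that respect the marking, the sequence and the metrics. * The *closed cell* $\widehat\Sigma_\Gamma$ of a marked graph $\Gamma$ is the set of points whose $\Gamma_0$ is obtained from $\Gamma$ by collapsing a (possibly empty) subforest, with the collapsed edges considered to have length $0$. Let $C$ be a core subgraph of $\Gamma$ or $\Gamma$ itself. The *level* of $C$ at a point is the unique $l$ such that $m_l$ is defined on (the image of) $C$ and is not identically zero there. The topology of $\widehat\Sigma_\Gamma$ is given by the metric $$d(x,x')=\sum_{C}\ \sum_{e\in E(C)}\left|\frac{m_l(e)}{m_l(C)}-\frac{m'_{l'}(e)}{m'_{l'}(C)}\right| ,$$ where $l,l'$ are the levels of $C$ at $x,x'$, and where $m_l(C)$ is the total length of $C$. A subset of $\widehat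 X_n$ is open if and only if its intersection with every closed cell is open in that cell. * Outer space $X_n\subset\widehat X_n$ is the set of points with $k=0$, and $\partial\widehat X_n=\widehat X_n\setminus X_n$. The subspace $Y_n\subset X_n$ consists of the graphs with no separating edges, $\widehat Y_n$ is the closure of $Y_n$ in $\widehat X_n$, and $\partial\widehat Y_n=\widehat Y_n\setminus Y_n$. * A *cut vertex* of a graph is a vertex whose deletion, as a point of the topological graph, disconnects the graph. (So a vertex of a connected graph with a loop at it and at least one other edge is a cut vertex.) -/

import Mathlib

open Set Topology

noncomputable section

namespace OuterSpace

/-! ### Finite graphs, edge paths, core subgraphs -/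

/-- A finite graph (loops and multiple edges allowed), described by its vertices and its darts
(oriented edges): `src d` is the initial vertex of `d`, and `inv d` is `d` with the opposite
orientation.  A geometric edge is a pair `{d, inv d}`. -/
structure FinGraph where
  V : Type
  D : Type
  [fintypeV : Fintype V]
  [fintypeD : Fintype D]
  src : D → V
  inv : D → D
  inv_inv : ∀ d, inv (inv d) = d
  inv_ne : ∀ d, inv d ≠ d

attribute [instance] FinGraph.fintypeV FinGraph.fintypeD

namespace FinGraph

variable (G : FinGraph)

/-- Terminal vertex of a dart. -/
def tgt (d : G.D) : G.V := G.src (G.inv d)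

/-- `G.IsPath u p v`: the list of darts `p` is an edge path from `u` to `v`. -/
def IsPath : G.V → List G.D → G.V → Prop
  | u, [], v => u = v
  | u, d :: p, v => G.src d = u ∧ IsPath (G.tgt d) p v

/-- An edge path is reduced if no dart is followed by its inverse. -/
def IsReduced (p : List G.D) : Prop := p.IsChain (fun d d' => d' ≠ G.inv d)

/-- `u` and `v` are joined by an edge path all of whose darts lie in `A`. -/
def JoinedIn (A : Set G.D) (u v : G.V) : Prop :=
  ∃ p, G.IsPath u p v ∧ ∀ d ∈ p, d ∈ A

/-- `G` is nonempty and connected. -/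
def Connected : Prop := Nonempty G.V ∧ ∀ u v, G.JoinedIn univ u v

/-- Valence of a vertex (a loop counts twice). -/
def valence (v : G.V) : ℕ := {d | G.src d = v}.ncard

/-- A set of darts that is a union of geometric edges; it stands for the subgraph spanned by
these edges. -/
def IsSubgraph (A : Set G.D) : Prop := ∀ d ∈ A, G.inv d ∈ A

/-- The edge of `d` is a separating edge of the subgraph `A`: once it is removed from `A`, its
endpoints are in different components. -/
def IsSeparatingIn (A : Set G.D) (d : G.D) : Prop :=
  ¬ G.JoinedIn (A \ {d, G.inv d}) (G.src d) (G.tgt d)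

/-- The subgraph `A` is a forest: each of its edges separates. -/
def IsForest (A : Set G.D) : Prop := ∀ d ∈ A, G.IsSeparatingIn A d

/-- A core subgraph: a (not necessarily connected) subgraph with no separating edges and no
vertices of valence `0` or `1`.  (As a subgraph is spanned by its edges, it has no vertices of
valence `0`.) -/
structure IsCore (A : Set G.D) : Prop where
  isSubgraph : G.IsSubgraph A
  not_separating : ∀ d ∈ A, ¬ G.IsSeparatingIn A d
  valence_ne_one : ∀ v, {d ∈ A | G.src d = v}.ncard ≠ 1

/-- The graph `G` has a separating edge. -/
def HasSeparatingEdge : Prop := ∃ d, G.IsSeparatingIn univ d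

/-- `v` is a cut vertex: the complement of the point `v` in the (topological) graph is
disconnected.  That is, the edges can be split into two nonempty sets in such a way that
edges from different sets meet at most at `v`. -/
def IsCutVertex (v : G.V) : Prop :=
  ∃ A : Set G.D, G.IsSubgraph A ∧ A.Nonempty ∧ Aᶜ.Nonempty ∧
    ∀ d ∈ A, ∀ d' ∉ A, G.src d = G.src d' → G.src d = v

/-- The graph `G` has a cut vertex. -/
def HasCutVertex : Prop := ∃ v, G.IsCutVertex v

/-- The volume of the subgraph `A` with respect to the edge lengths `m` (each edge consists of
two darts). -/
def vol (m : G.D → ℝ) (A : Set G.D) : ℝ := (∑ d, A.indicator m d) / 2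

end FinGraph

/-! ### Marked graphs -/

/-- The free group of rank `n`. -/
abbrev F (n : ℕ) : Type := FreeGroup (Fin n)

/-- A marked graph of rank `n`: a finite connected graph, all of whose vertices have valence at
least three, with a homotopy equivalence to the rose `R_n` (a homotopy inverse of the marking
`R_n → Γ`).

A map from `Γ` to `R_n` taking vertices to the vertex of `R_n` is, up to homotopy relative to the
vertices, a labelling of the darts by elements of `F_n = π₁(R_n)`.  It is a homotopy equivalence
if and only if it is an isomorphism on fundamental groups.  As the elements of `π₁(Γ, v)` are
represented uniquely by the reduced closed edge paths at `v`, this means that each element of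
`F_n` is the label of exactly one of these paths. -/
structure MarkedGraph (n : ℕ) extends FinGraph where
  connected : toFinGraph.Connected
  three_le_valence : ∀ v, 3 ≤ toFinGraph.valence v
  label : D → F n
  label_inv : ∀ d, label (inv d) = (label d)⁻¹
  marking : ∀ (v : V) (g : F n), ∃! p : List D,
    toFinGraph.IsPath v p v ∧ toFinGraph.IsReduced p ∧ (p.map label).prod = g

/-- An isomorphism of graphs respecting the markings.  The two maps to the rose have to agree up to
free homotopy: the homotopy moves the image of the vertex `v` along the loop `gauge v`. -/
structure MarkedGraph.Iso {n : ℕ} (G H : MarkedGraph n) where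
  onV : G.V ≃ H.V
  onD : G.D ≃ H.D
  src_onD : ∀ d, H.src (onD d) = onV (G.src d)
  inv_onD : ∀ d, H.inv (onD d) = onD (G.inv d)
  gauge : G.V → F n
  label_onD : ∀ d, H.label (onD d) = gauge (G.src d) * G.label d * (gauge (G.tgt d))⁻¹

/-- A collapse of `G` onto `H`: a map of marked graphs that collapses each component of a
subforest of `G` to a point.  The darts of `H` are identified through `edge` with those darts of
`G` that are not collapsed; the markings agree up to homotopy. -/
structure MarkedGraph.Collapse {n : ℕ} (G H : MarkedGraph n) where
  onV : G.V → H.V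
  edge : H.D → G.D
  edge_injective : Function.Injective edge
  inv_edge : ∀ d, G.inv (edge d) = edge (H.inv d)
  src_edge : ∀ d, onV (G.src (edge d)) = H.src d
  onV_eq_iff : ∀ u v, onV u = onV v ↔ G.JoinedIn (range edge)ᶜ u v
  isForest : G.IsForest (range edge)ᶜ
  gauge : G.V → F n
  label_edge : ∀ d, H.label d =
    gauge (G.src (edge d)) * G.label (edge d) * (gauge (G.tgt (edge d)))⁻¹
  label_collapsed : ∀ d ∉ range edge,
    gauge (G.src d) * G.label d * (gauge (G.tgt d))⁻¹ = 1

/-! ### The points of the bordification -/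

/-- A representative of a point of the bordification: a marked graph `Γ₀` with a nested sequence
`Γ₀ ⊃ Γ₁ ⊃ ⋯ ⊃ Γ_depth`, where `Γᵢ` carries the metric `m i` (edge lengths, extended by `0` to the
darts outside `Γᵢ`) of volume one, `Γᵢ₊₁` consists of the edges of `Γᵢ` of length zero,
`Γᵢ` is a core subgraph for `i ≥ 1`, and each edge has nonzero length in exactly one `Γᵢ`.
So `Γᵢ` consists of the edges on which all of `m 0, …, m (i - 1)` vanish. -/
structure Point (n : ℕ) where
  graph : MarkedGraph n
  depth : ℕ
  m : ℕ → graph.D → ℝ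
  m_nonneg : ∀ i d, 0 ≤ m i d
  m_inv : ∀ i d, m i (graph.inv d) = m i d
  nondegenerate : ∀ d, ∃! i, m i d ≠ 0
  le_depth : ∀ i d, m i d ≠ 0 → i ≤ depth
  vol_eq_one : ∀ i ≤ depth, graph.vol (m i) univ = 1
  isCore : ∀ i, 1 ≤ i → i ≤ depth → graph.IsCore {d | ∀ j < i, m j d = 0}

/-- Two representatives give the same point if there is an isomorphism of marked graphs
respecting the nested sequences and all the metrics. -/
def Point.Equivalent {n : ℕ} (x y : Point n) : Prop :=
  ∃ e : MarkedGraph.Iso x.graph y.graph, x.depth = y.depth ∧ ∀ i d, y.m i (e.onD d) = x.m i d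

theorem Point.Equivalent.refl {n : ℕ} (x : Point n) : x.Equivalent x :=
  ⟨⟨Equiv.refl _, Equiv.refl _, fun _ => rfl, fun _ => rfl, fun _ => 1, fun _ => by simp⟩,
    rfl, fun _ _ => rfl⟩

theorem Point.Equivalent.symm {n : ℕ} {x y : Point n} (h : x.Equivalent y) : y.Equivalent x := by
  obtain ⟨e, hk, hm⟩ := h
  have hsrc : ∀ d, x.graph.src (e.onD.symm d) = e.onV.symm (y.graph.src d) := fun d => by
    rw [Equiv.eq_symm_apply, ← e.src_onD, Equiv.apply_symm_apply]
  have hinv : ∀ d, x.graph.inv (e.onD.symm d) = e.onD.symm (y.graph.inv d) := fun d => by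
    rw [Equiv.eq_symm_apply, ← e.inv_onD, Equiv.apply_symm_apply]
  refine ⟨⟨e.onV.symm, e.onD.symm, hsrc, hinv, fun v => (e.gauge (e.onV.symm v))⁻¹, fun d => ?_⟩,
    hk.symm, fun i d => ?_⟩
  · have h1 := e.label_onD (e.onD.symm d)
    rw [Equiv.apply_symm_apply] at h1
    rw [h1]
    simp only [FinGraph.tgt, hsrc, hinv]
    group
  · rw [← hm, Equiv.apply_symm_apply]

theorem Point.Equivalent.trans {n : ℕ} {x y z : Point n} (h : x.Equivalent y)
    (h' : y.Equivalent z) : x.Equivalent z := by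
  obtain ⟨e, hk, hm⟩ := h
  obtain ⟨e', hk', hm'⟩ := h'
  refine ⟨⟨e.onV.trans e'.onV, e.onD.trans e'.onD, fun d => ?_, fun d => ?_,
    fun v => e'.gauge (e.onV v) * e.gauge v, fun d => ?_⟩, hk.trans hk', fun i d => ?_⟩
  · simp [e.src_onD, e'.src_onD]
  · simp [e.inv_onD, e'.inv_onD]
  · simp only [Equiv.trans_apply, e'.label_onD, e.label_onD, FinGraph.tgt, e.inv_onD, e.src_onD]
    group
  · simp [hm, hm']

instance Point.setoid (n : ℕ) : Setoid (Point n) where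
  r := Point.Equivalent
  iseqv := ⟨Point.Equivalent.refl, Point.Equivalent.symm, Point.Equivalent.trans⟩

/-- The bordification `X̂_n` of Outer space. -/
def XHat (n : ℕ) : Type 1 := Quotient (Point.setoid n)

/-- The point of `X̂_n` given by a representative. -/
def XHat.mk {n : ℕ} (x : Point n) : XHat n := Quotient.mk _ x

/-! ### The topology -/

/-- The closed cell of the marked graph `G`: the points whose underlying marked graph is obtained
from `G` by collapsing a (possibly empty) subforest. -/
def ClosedCell {n : ℕ} (G : MarkedGraph n) : Type 1 := Σ x : Point n, G.Collapse x.graph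

namespace ClosedCell

variable {n : ℕ} {G : MarkedGraph n} (y : ClosedCell G)

/-- The `i`-th metric of a point in the closed cell of `G`, as a function on the darts of `G`; the
collapsed darts have length zero. -/
def metric (i : ℕ) : G.D → ℝ := Function.extend y.2.edge (y.1.m i) 0

/-- The level of a subgraph `C` of `G`: the index of the first (and only) metric that is defined
on the image of `C` and is not identically zero there. -/
def level (C : Set G.D) : ℕ := sInf {i | G.vol (y.metric i) C ≠ 0}

/-- The coordinates of a point in the closed cell of `G`: for `C` either a core subgraph of `G` or
`G` itself, the lengths of the edges of `C` in the metric of the level of `C`, normalized so that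
`C` has volume one. -/
def coord (C : {C : Set G.D // G.IsCore C ∨ C = univ}) (d : C.1) : ℝ :=
  y.metric (y.level C) d / G.vol (y.metric (y.level C)) C

/-- The topology of the closed cell is the one given by the coordinates, equivalently by the
pseudometric that is the sum over `C` and over the edges of `C` of the absolute values of the
differences of the coordinates. -/
instance : TopologicalSpace (ClosedCell G) := TopologicalSpace.induced coord inferInstance

end ClosedCell

/-- The topology of `X̂_n`: a set is open if and only if its intersection with each closed cell is
open in the closed cell. -/
instance (n : ℕ) : TopologicalSpace (XHat n) :=
  ⨆ G : MarkedGraph n, TopologicalSpace.coinduced (fun y : ClosedCell G => XHat.mk y.1) inferInstance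

/-! ### The action of `Out(F_n)` -/

instance (n : ℕ) : (MulAut.conj : F n →* MulAut (F n)).range.Normal where
  conj_mem := by
    rintro _ ⟨g, rfl⟩ a
    exact ⟨a g, by ext; simp [MulAut.conj_apply]⟩

/-- The group `Out(F_n)` of outer automorphisms of the free group. -/
abbrev Out (n : ℕ) : Type := MulAut (F n) ⧸ (MulAut.conj : F n →* MulAut (F n)).range

/-- An automorphism of `F_n` acts on marked graphs by changing the marking: the homotopy
equivalence to the rose is followed by the automorphism. -/
def MarkedGraph.twist {n : ℕ} (a : MulAut (F n)) (G : MarkedGraph n) : MarkedGraph n where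
  toFinGraph := G.toFinGraph
  connected := G.connected
  three_le_valence := G.three_le_valence
  label d := a (G.label d)
  label_inv d := by rw [G.label_inv, map_inv]
  marking v g := by
    have key : ∀ p : List G.D, (p.map fun d => a (G.label d)).prod = g ↔
        (p.map G.label).prod = a.symm g := fun p => by
      rw [MulEquiv.eq_symm_apply, map_list_prod, List.map_map]
      rfl
    simpa only [key] using G.marking v (a.symm g)

/-- The action of automorphisms on representatives of points. -/
def Point.twist {n : ℕ} (a : MulAut (F n)) (x : Point n) : Point n where
  graph := x.graph.twist a
  depth := x.depth
  m := x.m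
  m_nonneg := x.m_nonneg
  m_inv := x.m_inv
  nondegenerate := x.nondegenerate
  le_depth := x.le_depth
  vol_eq_one := x.vol_eq_one
  isCore := x.isCore

theorem Point.Equivalent.twist {n : ℕ} (a : MulAut (F n)) {x y : Point n} (h : x.Equivalent y) :
    (x.twist a).Equivalent (y.twist a) := by
  obtain ⟨e, hk, hm⟩ := h
  refine ⟨⟨e.onV, e.onD, e.src_onD, e.inv_onD, fun v => a (e.gauge v), fun d => ?_⟩, hk, hm⟩
  refine (congrArg a (e.label_onD d)).trans ?_
  rw [map_mul, map_mul, map_inv]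
  rfl

theorem Point.twist_conj_equivalent {n : ℕ} (g : F n) (x : Point n) :
    (x.twist (MulAut.conj g)).Equivalent x := by
  refine ⟨⟨Equiv.refl _, Equiv.refl _, fun _ => rfl, fun _ => rfl, fun _ => g⁻¹, fun d => ?_⟩,
    rfl, fun _ _ => rfl⟩
  change x.graph.label d = g⁻¹ * (g * x.graph.label d * g⁻¹) * (g⁻¹)⁻¹
  group

instance (n : ℕ) : MulAction (MulAut (F n)) (XHat n) where
  smul a := Quotient.map (Point.twist a) fun _ _ h => h.twist a
  one_smul := by rintro ⟨x⟩; rfl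
  mul_smul := by rintro a b ⟨x⟩; rfl

theorem conj_smul {n : ℕ} (g : F n) (x : XHat n) : MulAut.conj g • x = x := by
  obtain ⟨x⟩ := x
  exact Quotient.sound (x.twist_conj_equivalent g)

/-- The action of `Out(F_n)` on `X̂_n`. -/
instance (n : ℕ) : MulAction (Out n) (XHat n) :=
  MulAction.compHom (XHat n)
    (QuotientGroup.lift (MulAut.conj : F n →* MulAut (F n)).range
      (MulAction.toPermHom (MulAut (F n)) (XHat n))
      (by
        rintro _ ⟨g, rfl⟩
        ext x
        exact conj_smul g x))

theorem out_smul_mk {n : ℕ} (a : MulAut (F n)) (x : Point n) :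
    (QuotientGroup.mk a : Out n) • XHat.mk x = XHat.mk (x.twist a) := rfl

/-! ### Subspaces of the bordification -/

/-- Outer space `X_n`, the interior of `X̂_n`: the points with no degenerate core subgraph. -/
def X (n : ℕ) : Set (XHat n) := {z | ∃ x : Point n, XHat.mk x = z ∧ x.depth = 0}

/-- The boundary `∂X̂_n`. -/
def boundaryXHat (n : ℕ) : Set (XHat n) := (X n)ᶜ

/-- The subspace `Y_n` of `X_n` of graphs with no separating edges. -/
def Y (n : ℕ) : Set (XHat n) :=
  {z | ∃ x : Point n, XHat.mk x = z ∧ x.depth = 0 ∧ ¬ x.graph.HasSeparatingEdge}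

/-- `Ŷ_n`, the closure of `Y_n` in `X̂_n`. -/
def YHat (n : ℕ) : Set (XHat n) := closure (Y n)

/-- The boundary `∂Ŷ_n`. -/
def boundaryYHat (n : ℕ) : Set (XHat n) := YHat n \ Y n

/-- The set of graphs in `Y_n` which have a cut vertex. -/
def cutVertexGraphs (n : ℕ) : Set (XHat n) :=
  {z | ∃ x : Point n, XHat.mk x = z ∧ x.depth = 0 ∧ ¬ x.graph.HasSeparatingEdge ∧
    x.graph.HasCutVertex}

/-- `φ` is a `Γ`-equivariant (strong) deformation retraction of the space `Z` onto the
subspace `A`: it starts at the identity, ends in `A`, fixes `A` pointwise at all times, and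
commutes with the action at all times. -/
structure IsEquivariantDeformationRetraction (Γ : Type*) {Z : Type*} [Group Γ] [MulAction Γ Z]
    [TopologicalSpace Z] (A : Set Z) (φ : Z × unitInterval → Z) : Prop where
  continuous : Continuous φ
  map_zero : ∀ z, φ (z, 0) = z
  map_one : ∀ z, φ (z, 1) ∈ A
  fixes : ∀ z ∈ A, ∀ t, φ (z, t) = z
  equivariant : ∀ (g : Γ) (z : Z) (t : unitInterval), φ (g • z, t) = g • φ (z, t)

end OuterSpace

end

open Set Topology

noncomputable section

namespace OuterSpace

namespace FinGraph

variable {G : FinGraph} {A B : Set G.D} {u v w : G.V} {p q : List G.D} {d : G.D}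

/-! ### Edge paths -/

/-! The retraction shrinks the separating edges. In a graph Γ let `core` be the set of nonseparating
edges; it is the largest core subgraph, and its complement is a forest. At a point with metrics m_0,
m_1, ..., let l be the level of `core`. The flow moves m_0 linearly to the normalized restriction of
m_l to `core`, and for t > 0 discards the metrics m_1, ..., m_l. At t = 1 the separating edges have
length zero and are collapsed. Since Γ_1 is itself a core subgraph, it contains no separating edge,
so every separating edge has positive m_0-length; hence l is 0 or 1 (`Point.coreLevel_le_one`), and
`Point.exists_flow` shows that the new metrics again define a point.

The index l jumps, but the coordinates of a closed cell do not see this. For a core subgraph C,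
which lies in `core`, the flow only rescales the relevant metric on C, so the coordinates of C are
constant (`ClosedCell.coord_flow_of_subset`). The coordinates of the whole graph are a convex
combination of the old ones and those of `core` (`ClosedCell.coord_flow_univ`). So the flow is
continuous on closed cells. It is compatible with collapses (`ClosedCell.flow_pullback`), hence
descends to the bordification; continuity jointly with time follows by currying, as the interval is
locally compact.

The closure of Y_n is the set of points whose graph has no separating edge (`XHat.YHat_eq`). This
set is closed, because it is given in each cell by the vanishing of coordinates. Conversely, such a
point is the limit, as ε tends to 0, of the points of Y_n with metric proportional to ∑ ε^i m_i. On
these points the flow is stationary.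

For the image of the boundary: a boundary point flows into Outer space only if l = 1 and the depth
is 1. Then some separating edge is collapsed, which creates a cut vertex
(`Contraction.hasCutVertex`). Conversely, a cut vertex of a graph without separating edges can be
split by a new separating edge (`MarkedGraph.exists_split`); putting all of m_0 on that edge and the
given metric in m_1 gives a boundary point that flows to the given graph
(`Point.flow_degeneration`). Points of the boundary of the closure of Y_n are fixed and lie on the
boundary already. -/

@[simp] theorem src_inv (d : G.D) : G.src (G.inv d) = G.tgt d := rfl

@[simp] theorem tgt_inv (d : G.D) : G.tgt (G.inv d) = G.src d := by
  rw [tgt, G.inv_inv]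

@[simp] theorem inv_inv' (d : G.D) : G.inv (G.inv d) = d := G.inv_inv d

@[simp] theorem isPath_nil : G.IsPath u [] v ↔ u = v := Iff.rfl

@[simp] theorem isPath_cons : G.IsPath u (d :: p) v ↔ G.src d = u ∧ G.IsPath (G.tgt d) p v :=
  Iff.rfl

theorem isPath_append : G.IsPath u (p ++ q) w ↔ ∃ v, G.IsPath u p v ∧ G.IsPath v q w := by
  induction p generalizing u with
  | nil => simp
  | cons d p ih => simp [ih, and_assoc]

/-- The reversed edge path. -/
def rev (p : List G.D) : List G.D := (p.map G.inv).reverse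

@[simp] theorem rev_cons : G.rev (d :: p) = G.rev p ++ [G.inv d] := by simp [rev]

theorem mem_rev : d ∈ G.rev p ↔ G.inv d ∈ p := by
  simp only [rev, List.mem_reverse, List.mem_map]
  constructor
  · rintro ⟨a, ha, rfl⟩
    simpa using ha
  · exact fun h => ⟨_, h, by simp⟩

theorem IsPath.rev (h : G.IsPath u p v) : G.IsPath v (G.rev p) u := by
  induction p generalizing u with
  | nil => exact h.symm
  | cons d p ih =>
    rw [rev_cons, isPath_append]
    exact ⟨_, ih h.2, by simpa using h.1⟩

theorem IsReduced.rev (h : G.IsReduced p) : G.IsReduced (G.rev p) := by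
  unfold IsReduced FinGraph.rev at *
  rw [List.isChain_reverse, List.isChain_map]
  refine h.imp fun a b hab hba => hab ?_
  simpa using hba.symm

theorem JoinedIn.refl (A : Set G.D) (u : G.V) : G.JoinedIn A u u := ⟨[], rfl, by simp⟩

theorem JoinedIn.trans (h : G.JoinedIn A u v) (h' : G.JoinedIn A v w) : G.JoinedIn A u w := by
  obtain ⟨p, hp, hpA⟩ := h
  obtain ⟨q, hq, hqA⟩ := h'
  refine ⟨p ++ q, isPath_append.2 ⟨_, hp, hq⟩, fun d hd => ?_⟩
  rcases List.mem_append.1 hd with hd | hd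
  exacts [hpA d hd, hqA d hd]

theorem JoinedIn.symm (hA : G.IsSubgraph A) (h : G.JoinedIn A u v) : G.JoinedIn A v u := by
  obtain ⟨p, hp, hpA⟩ := h
  exact ⟨_, hp.rev, fun d hd => by simpa using hA _ (hpA _ (mem_rev.1 hd))⟩

theorem JoinedIn.mono (hAB : A ⊆ B) (h : G.JoinedIn A u v) : G.JoinedIn B u v := by
  obtain ⟨p, hp, hpA⟩ := h
  exact ⟨p, hp, fun d hd => hAB (hpA d hd)⟩

theorem joinedIn_dart (hd : d ∈ A) : G.JoinedIn A (G.src d) (G.tgt d) :=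
  ⟨[d], ⟨rfl, rfl⟩, by simpa using hd⟩

theorem IsSubgraph.inv_mem_iff (hA : G.IsSubgraph A) : G.inv d ∈ A ↔ d ∈ A :=
  ⟨fun h => by simpa using hA _ h, hA d⟩

theorem isSubgraph_univ : G.IsSubgraph univ := fun _ _ => mem_univ _

theorem IsSubgraph.compl (hA : G.IsSubgraph A) : G.IsSubgraph Aᶜ :=
  fun _ hd h => hd (hA.inv_mem_iff.1 h)

theorem IsSubgraph.diff_edge (hA : G.IsSubgraph A) (d : G.D) :
    G.IsSubgraph (A \ {d, G.inv d}) := by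
  rintro a ⟨ha, had⟩
  refine ⟨hA a ha, fun h => had ?_⟩
  rcases h with h | h
  · exact Or.inr (by rw [← h]; simp)
  · exact Or.inl (by simpa using congrArg G.inv h)

theorem IsSeparatingIn.mono (hAB : A ⊆ B) (h : G.IsSeparatingIn B d) : G.IsSeparatingIn A d :=
  fun h' => h (h'.mono (sdiff_subset_sdiff_left hAB))

theorem isSeparatingIn_inv (hA : G.IsSubgraph A) :
    G.IsSeparatingIn A (G.inv d) ↔ G.IsSeparatingIn A d := by
  have key : A \ {G.inv d, G.inv (G.inv d)} = A \ {d, G.inv d} := by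
    rw [inv_inv', pair_comm]
  rw [IsSeparatingIn, IsSeparatingIn, key, src_inv, tgt_inv]
  exact not_congr ⟨JoinedIn.symm (hA.diff_edge d), JoinedIn.symm (hA.diff_edge d)⟩

/-- Every edge path can be made reduced, without changing its label. -/
theorem IsPath.exists_isReduced {M : Type*} [Group M] (f : G.D → M)
    (hf : ∀ d, f (G.inv d) = (f d)⁻¹) (h : G.IsPath u p v) :
    ∃ q, G.IsPath u q v ∧ G.IsReduced q ∧ (∀ d ∈ q, d ∈ p) ∧ (q.map f).prod = (p.map f).prod := by
  induction p generalizing u with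
  | nil => exact ⟨[], h, List.isChain_nil, by simp, rfl⟩
  | cons d p ih =>
    obtain ⟨q, hq, hqr, hqp, hqf⟩ := ih h.2
    cases q with
    | nil =>
      refine ⟨[d], ⟨h.1, hq⟩, List.isChain_singleton _, by simp, ?_⟩
      simp only [List.map_cons, List.prod_cons, ← hqf]
    | cons e q =>
      by_cases he : e = G.inv d
      · refine ⟨q, ?_, hqr.tail, fun a ha => List.mem_cons_of_mem _
          (hqp a (List.mem_cons_of_mem _ ha)), ?_⟩
        · have := hq.2
          rw [he, tgt_inv, h.1] at this
          exact this
        · simp only [List.map_cons, List.prod_cons, ← hqf, he, hf]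
          group
      · refine ⟨d :: e :: q, ⟨h.1, hq⟩, List.isChain_cons_cons.2 ⟨he, hqr⟩, fun a ha => ?_, ?_⟩
        · rcases List.mem_cons.1 ha with rfl | ha
          exacts [List.mem_cons_self, List.mem_cons_of_mem _ (hqp a ha)]
        · simp only [List.map_cons, List.prod_cons, ← hqf]

theorem JoinedIn.exists_isReduced (h : G.JoinedIn A u v) :
    ∃ p, G.IsPath u p v ∧ G.IsReduced p ∧ ∀ d ∈ p, d ∈ A := by
  obtain ⟨p, hp, hpA⟩ := h
  -- Labels are irrelevant here, so the trivial labelling is used.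
  obtain ⟨q, hq, hqr, hqp, -⟩ := hp.exists_isReduced (fun _ => (1 : Multiplicative ℤ)) (by simp)
  exact ⟨q, hq, hqr, fun d hd => hpA d (hqp d hd)⟩

/-! ### Forests -/

/-- Induction on length. If the edge of the first dart is used again, a shorter closed reduced path
is cut out; otherwise the rest of the path joins the ends of that edge without using it, so the edge
does not separate. -/
theorem IsForest.eq_nil (hA : G.IsSubgraph A) (h : G.IsForest A) (hp : G.IsPath u p u)
    (hr : G.IsReduced p) (hpA : ∀ d ∈ p, d ∈ A) : p = [] := by
  induction hk : p.length using Nat.strong_induction_on generalizing u p with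
  | _ k ih =>
  cases p with
  | nil => rfl
  | cons d q =>
    exfalso
    obtain ⟨hdu, hq⟩ := hp
    by_cases h1 : d ∈ q
    · obtain ⟨q₁, q₂, rfl⟩ := List.append_of_mem h1
      obtain ⟨x, hx1, hx2⟩ := isPath_append.1 hq
      have hc : G.IsPath (G.src d) (d :: q₁) (G.src d) := ⟨rfl, by rw [hx2.1]; exact hx1⟩
      have hr1 : G.IsReduced (d :: q₁) :=
        List.IsChain.left_of_append (l₂ := d :: q₂) (by simpa [IsReduced] using hr)
      have := ih (d :: q₁).length (by simp at hk ⊢; omega) hc hr1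
        (fun a ha => hpA a (by simp at ha ⊢; tauto)) rfl
      simp at this
    by_cases h2 : G.inv d ∈ q
    · obtain ⟨q₁, q₂, rfl⟩ := List.append_of_mem h2
      obtain ⟨x, hx1, hx2⟩ := isPath_append.1 hq
      have hc : G.IsPath (G.tgt d) q₁ (G.tgt d) := by
        have := hx2.1
        rw [src_inv] at this
        rw [this]
        rw [this] at hx1
        exact hx1
      have hr1 : G.IsReduced q₁ := List.IsChain.left_of_append (l₂ := G.inv d :: q₂) hr.tail
      have := ih q₁.length (by simp at hk ⊢; omega) hc hr1
        (fun a ha => hpA a (by simp at ha ⊢; tauto)) rfl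
      subst this
      exact (List.isChain_cons_cons.1 hr).1 rfl
    · have hdA := hpA d (by simp)
      refine h d hdA (JoinedIn.symm (hA.diff_edge d) ⟨q, by rw [hdu]; exact hq, fun a ha => ?_⟩)
      refine ⟨hpA a (by simp [ha]), ?_⟩
      rintro (rfl | rfl)
      exacts [h1 ha, h2 ha]

theorem isForest_of_eq_nil
    (h : ∀ u p, G.IsPath u p u → G.IsReduced p → (∀ d ∈ p, d ∈ A) → p = [])
    (hA : G.IsSubgraph A) : G.IsForest A := by
  intro d hd hj
  obtain ⟨p, hp, hpr, hpA⟩ := hj.exists_isReduced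
  have := h (G.tgt d) (G.inv d :: p) ⟨rfl, by simpa using hp⟩ ?_ ?_
  · simp at this
  · cases p with
    | nil => exact List.isChain_singleton _
    | cons e p =>
      refine List.isChain_cons_cons.2 ⟨fun he => (hpA e (by simp)).2 ?_, hpr⟩
      exact Or.inl (by simpa using he)
  · intro a ha
    rcases List.mem_cons.1 ha with rfl | ha
    exacts [hA d hd, (hpA a ha).1]

theorem isForest_empty : G.IsForest ∅ := fun _ h => h.elim

/-- Where two reduced paths diverge, the reverse of one followed by the other is a closed reduced
path, contradicting `IsForest.eq_nil`. -/
theorem IsForest.unique (hA : G.IsSubgraph A) (h : G.IsForest A) (hp : G.IsPath u p v)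
    (hq : G.IsPath u q v) (hpr : G.IsReduced p) (hqr : G.IsReduced q) (hpA : ∀ d ∈ p, d ∈ A)
    (hqA : ∀ d ∈ q, d ∈ A) : p = q := by
  induction p generalizing u q with
  | nil =>
    obtain rfl : u = v := hp
    exact (h.eq_nil hA hq hqr hqA).symm
  | cons d p ih =>
    cases q with
    | nil =>
      obtain rfl : u = v := hq
      exact h.eq_nil hA hp hpr hpA
    | cons e q =>
      by_cases hde : e = d
      · subst hde
        rw [ih hp.2 hq.2 hpr.tail hqr.tail (fun a ha => hpA a (by simp [ha]))
          (fun a ha => hqA a (by simp [ha]))]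
      · have := h.eq_nil (p := G.rev (d :: p) ++ (e :: q)) hA
          (isPath_append.2 ⟨_, hp.rev, hq⟩) ?_ ?_
        · simp at this
        · refine List.isChain_append.2 ⟨hpr.rev, hqr, ?_⟩
          simpa [eq_comm] using hde
        · intro a ha
          rcases List.mem_append.1 ha with ha | ha
          · exact hA.inv_mem_iff.1 (hpA _ (mem_rev.1 ha))
          · exact hqA a ha

theorem IsForest.prod_eq {M : Type*} [Group M] {f : G.D → M}
    (hf : ∀ d, f (G.inv d) = (f d)⁻¹) (hA : G.IsSubgraph A) (h : G.IsForest A)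
    (hp : G.IsPath u p v) (hq : G.IsPath u q v) (hpA : ∀ d ∈ p, d ∈ A) (hqA : ∀ d ∈ q, d ∈ A) :
    (p.map f).prod = (q.map f).prod := by
  obtain ⟨p', hp', hpr, hpp, hpf⟩ := hp.exists_isReduced f hf
  obtain ⟨q', hq', hqr, hqq, hqf⟩ := hq.exists_isReduced f hf
  rw [← hpf, ← hqf, h.unique hA hp' hq' hpr hqr (fun d hd => hpA d (hpp d hd))
    (fun d hd => hqA d (hqq d hd))]

theorem IsForest.not_mem_tail (hA : G.IsSubgraph A) (h : G.IsForest A)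
    (hp : G.IsPath u (d :: q) v) (hr : G.IsReduced (d :: q)) (hpA : ∀ a ∈ d :: q, a ∈ A) :
    G.src d ∉ q.map G.src ∧ G.inv d ∉ q := by
  constructor
  · intro h1
    obtain ⟨e, he, hed⟩ := List.mem_map.1 h1
    obtain ⟨q₁, q₂, rfl⟩ := List.append_of_mem he
    obtain ⟨x, hx1, hx2⟩ := isPath_append.1 hp.2
    have hc : G.IsPath (G.src d) (d :: q₁) (G.src d) := ⟨rfl, by rw [← hed, hx2.1]; exact hx1⟩
    have hr1 : G.IsReduced (d :: q₁) :=
      List.IsChain.left_of_append (l₂ := e :: q₂) (by simpa [IsReduced] using hr)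
    have := h.eq_nil hA hc hr1 (fun a ha => hpA a (by simp at ha ⊢; tauto))
    simp at this
  · intro h2
    obtain ⟨q₁, q₂, rfl⟩ := List.append_of_mem h2
    obtain ⟨x, hx1, hx2⟩ := isPath_append.1 hp.2
    have hx : x = G.tgt d := hx2.1.symm.trans (src_inv d)
    rw [hx] at hx1
    have := h.eq_nil hA hx1 (List.IsChain.left_of_append (l₂ := G.inv d :: q₂) hr.tail)
      (fun a ha => hpA a (by simp at ha ⊢; tauto))
    subst this
    exact (List.isChain_cons_cons.1 hr).1 rfl

theorem IsForest.nodup (hA : G.IsSubgraph A) (h : G.IsForest A) (hp : G.IsPath u p v)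
    (hr : G.IsReduced p) (hpA : ∀ a ∈ p, a ∈ A) : (p.map G.src).Nodup := by
  induction p generalizing u with
  | nil => simp
  | cons d q ih =>
    rw [List.map_cons, List.nodup_cons]
    exact ⟨(h.not_mem_tail hA hp hr hpA).1,
      ih hp.2 hr.tail (fun a ha => hpA a (by simp [ha]))⟩

/-- Following a dart of a forest as far as possible, one arrives at a vertex at which the forest
has only one dart. -/
theorem IsForest.exists_leaf (hA : G.IsSubgraph A) (h : G.IsForest A) (hd : d ∈ A) :
    ∃ q v e, G.IsPath (G.tgt d) q v ∧ (∀ a ∈ q, a ∈ A \ {d, G.inv d}) ∧ v ≠ G.src d ∧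
      e ∈ A ∧ G.src e = v ∧ ∀ a ∈ A, G.src a = v → a = e := by
  classical
  let P : ℕ → Prop := fun k => ∃ q v, q.length = k ∧ G.IsPath (G.src d) (d :: q) v ∧
    G.IsReduced (d :: q) ∧ ∀ a ∈ d :: q, a ∈ A
  -- A reduced path in a forest has distinct initial vertices, so its length is bounded and a
  -- longest one starting with `d` exists.
  have hb : ∀ k, P k → k ≤ Fintype.card G.V := by
    rintro k ⟨q, v, rfl, hp, hr, hpA⟩
    have := (h.nodup hA hp hr hpA).length_le_card
    simp at this
    omega
  have h0 : P 0 := ⟨[], _, rfl, ⟨rfl, rfl⟩, List.isChain_singleton _, by simpa using hd⟩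
  have hP := Nat.findGreatest_spec (P := P) (Nat.zero_le (Fintype.card G.V)) h0
  obtain ⟨q, v, hq, hp, hr, hpA⟩ := hP
  have hnm := h.not_mem_tail hA hp hr hpA
  have hdq : d ∉ q := fun h => hnm.1 (List.mem_map_of_mem h)
  refine ⟨q, v, G.inv ((d :: q).getLast (by simp)), hp.2, fun a ha => ⟨hpA a (by simp [ha]), ?_⟩,
    ?_, hA _ (hpA _ (List.getLast_mem _)), ?_, ?_⟩
  · rintro (rfl | rfl)
    exacts [hdq ha, hnm.2 ha]
  · rintro rfl
    have := h.eq_nil hA hp hr hpA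
    simp at this
  · rw [src_inv]
    have hp' := hp
    rw [← List.dropLast_append_getLast (l := d :: q) (by simp), isPath_append] at hp'
    obtain ⟨x, -, hx⟩ := hp'
    exact hx.2
  · intro a ha hav
    by_contra hne
    have hP' : P (q.length + 1) := by
      refine ⟨q ++ [a], G.tgt a, by simp, ⟨rfl, isPath_append.2 ⟨v, hp.2, hav, rfl⟩⟩, ?_, ?_⟩
      · have : G.IsReduced ((d :: q) ++ [a]) := by
          refine List.isChain_append.2 ⟨hr, List.isChain_singleton _, ?_⟩
          intro x hx y hy
          rw [List.getLast?_eq_getLast_of_ne_nil (by simp)] at hx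
          simp only [Option.mem_def, Option.some.injEq, List.head?_cons] at hx hy
          rw [← hx, ← hy]
          exact hne
        exact this
      · intro x hx
        simp only [List.mem_cons, List.mem_append, List.not_mem_nil, or_false] at hx
        rcases hx with rfl | hx | rfl
        exacts [hd, hpA x (by simp [hx]), ha]
    have := Nat.le_findGreatest (hb _ hP') hP'
    omega

/-- If all valences are at least three, each dart of a forest leads to a vertex with at least two
darts outside of the forest. -/
theorem IsForest.exists_two (hA : G.IsSubgraph A) (h : G.IsForest A)
    (hG : ∀ v, 3 ≤ G.valence v) (hd : d ∈ A) :
    ∃ v e, G.JoinedIn (A \ {d, G.inv d}) (G.tgt d) v ∧ v ≠ G.src d ∧ e ∈ A ∧ G.src e = v ∧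
      2 ≤ {a | G.src a = v ∧ a ∉ A}.ncard := by
  obtain ⟨q, v, e, hq, hqA, hv, he, hev, hu⟩ := h.exists_leaf hA hd
  refine ⟨v, e, ⟨q, hq, hqA⟩, hv, he, hev, ?_⟩
  have h1 : {a | G.src a = v} ⊆ insert e {a | G.src a = v ∧ a ∉ A} := by
    intro a ha
    by_cases haA : a ∈ A
    exacts [Or.inl (hu a haA ha), Or.inr ⟨ha, haA⟩]
  have h2 := (ncard_le_ncard h1 (toFinite _)).trans (ncard_insert_le _ _)
  have := hG v
  unfold valence at this
  omega

/-- The valence condition is automatic: the edge of a lone dart at a vertex is not a loop, which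
would give a second dart there, so removing it isolates the vertex and the edge separates. -/
theorem isCore_iff : G.IsCore A ↔ G.IsSubgraph A ∧ ∀ d ∈ A, ¬ G.IsSeparatingIn A d := by
  refine ⟨fun h => ⟨h.1, h.2⟩, fun ⟨h1, h2⟩ => ⟨h1, h2, fun v hv => ?_⟩⟩
  obtain ⟨d, hd⟩ := ncard_eq_one.1 hv
  have hd' : d ∈ A ∧ G.src d = v := (Set.ext_iff.1 hd d).2 rfl
  obtain ⟨p, hp, hpA⟩ := not_not.1 (h2 d hd'.1)
  cases p with
  | nil =>
    have : G.inv d ∈ ({d} : Set G.D) := by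
      rw [← hd]
      exact ⟨h1 d hd'.1, by rw [src_inv, ← hd'.2]; exact hp.symm⟩
    exact G.inv_ne d this
  | cons e p =>
    have he := hpA e (by simp)
    have : e ∈ ({d} : Set G.D) := by
      rw [← hd]
      exact ⟨he.1, hp.1.trans hd'.2⟩
    exact he.2 (Or.inl this)

end FinGraph

namespace FinGraph

/-! ### Contractions of subforests -/

/-- A map of graphs that collapses each component of a subforest of `G` to a point. -/
structure Contraction (G H : FinGraph) where
  onV : G.V → H.V
  edge : H.D → G.D
  edge_injective : Function.Injective edge
  inv_edge : ∀ d, G.inv (edge d) = edge (H.inv d)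
  src_edge : ∀ d, onV (G.src (edge d)) = H.src d
  onV_eq_iff : ∀ u v, onV u = onV v ↔ G.JoinedIn (range edge)ᶜ u v
  isForest : G.IsForest (range edge)ᶜ

namespace Contraction

variable {G H K : FinGraph} (c : Contraction G H) {A : Set G.D} {B : Set H.D} {u v : G.V}
  {p p' : List G.D} {q : List H.D} {d : G.D} {e : H.D}

/-- The subforest that is collapsed. -/
def collapsed : Set G.D := (range c.edge)ᶜ

theorem edge_not_mem (e : H.D) : c.edge e ∉ c.collapsed := fun h => h ⟨e, rfl⟩

theorem eq_edge_of_not_mem (hd : d ∉ c.collapsed) : ∃ e, c.edge e = d := not_not.1 hd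

theorem isSubgraph_collapsed : G.IsSubgraph c.collapsed := by
  rintro d hd ⟨e, he⟩
  exact hd ⟨H.inv e, by rw [← c.inv_edge, he, inv_inv']⟩

theorem tgt_edge (e : H.D) : c.onV (G.tgt (c.edge e)) = H.tgt e := by
  rw [tgt, c.inv_edge, c.src_edge, tgt]

theorem onV_src_eq_tgt (hd : d ∈ c.collapsed) : c.onV (G.src d) = c.onV (G.tgt d) :=
  (c.onV_eq_iff _ _).2 (joinedIn_dart hd)

theorem onV_surjective (hH : ∀ v, ∃ e, H.src e = v) : Function.Surjective c.onV := fun v => by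
  obtain ⟨e, rfl⟩ := hH v
  exact ⟨_, c.src_edge e⟩

open Classical in
/-- The dart of `H` given by a dart of `G` that is not collapsed. -/
def proj (d : G.D) : Option H.D := if h : ∃ e, c.edge e = d then some h.choose else none

@[simp] theorem proj_edge (e : H.D) : c.proj (c.edge e) = some e := by
  have h : ∃ e', c.edge e' = c.edge e := ⟨e, rfl⟩
  rw [proj, dif_pos h, c.edge_injective h.choose_spec]

theorem proj_eq_none : c.proj d = none ↔ d ∈ c.collapsed := by
  unfold proj
  split_ifs with h
  · simpa [collapsed] using h
  · simpa [collapsed] using h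

theorem proj_eq_some : c.proj d = some e ↔ c.edge e = d := by
  refine ⟨fun h => ?_, by rintro rfl; simp⟩
  by_cases hd : d ∈ c.collapsed
  · rw [c.proj_eq_none.2 hd] at h
    simp at h
  · obtain ⟨e', rfl⟩ := c.eq_edge_of_not_mem hd
    rw [proj_edge] at h
    rw [Option.some.inj h]

/-- The image of an edge path. -/
def map (p : List G.D) : List H.D := p.filterMap c.proj

@[simp] theorem map_nil : c.map [] = [] := rfl

@[simp] theorem map_cons_edge : c.map (c.edge e :: p) = e :: c.map p := by
  simp [map]

theorem map_cons_collapsed (hd : d ∈ c.collapsed) : c.map (d :: p) = c.map p := by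
  simp [map, c.proj_eq_none.2 hd]

theorem map_append : c.map (p ++ p') = c.map p ++ c.map p' := by
  simp [map]

theorem mem_map : e ∈ c.map p ↔ c.edge e ∈ p := by
  simp [map, proj_eq_some]

theorem map_eq_nil : c.map p = [] ↔ ∀ d ∈ p, d ∈ c.collapsed := by
  simp [map, proj_eq_none]

theorem isPath_map (h : G.IsPath u p v) : H.IsPath (c.onV u) (c.map p) (c.onV v) := by
  induction p generalizing u with
  | nil => exact congrArg c.onV h
  | cons d p ih =>
    obtain ⟨rfl, hp⟩ := h
    by_cases hd : d ∈ c.collapsed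
    · rw [c.map_cons_collapsed hd, c.onV_src_eq_tgt hd]
      exact ih hp
    · obtain ⟨e, rfl⟩ := c.eq_edge_of_not_mem hd
      rw [map_cons_edge]
      exact ⟨(c.src_edge e).symm, by rw [← c.tgt_edge]; exact ih hp⟩

/-- A backtrack in the image comes from an edge, a closed reduced path in the collapsed forest, and
the inverse edge. The middle part is empty, so the original path backtracked already. -/
theorem isReduced_map (h : G.IsPath u p v) (hr : G.IsReduced p) : H.IsReduced (c.map p) := by
  induction p generalizing u with
  | nil => exact List.isChain_nil
  | cons d p ih =>
    obtain ⟨rfl, hp⟩ := h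
    have ih := ih hp hr.tail
    by_cases hd : d ∈ c.collapsed
    · rwa [c.map_cons_collapsed hd]
    obtain ⟨e, rfl⟩ := c.eq_edge_of_not_mem hd
    rw [map_cons_edge]
    rcases hm : c.map p with - | ⟨e', q⟩
    · exact List.isChain_singleton _
    refine List.isChain_cons_cons.2 ⟨?_, hm ▸ ih⟩
    rintro rfl
    obtain ⟨p₁, a, p₂, rfl, h1, h2, -⟩ := List.filterMap_eq_cons_iff.1 hm
    obtain rfl := c.proj_eq_some.1 h2
    obtain ⟨x, hx1, hx2⟩ := isPath_append.1 hp
    have hx : x = G.tgt (c.edge e) := by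
      rw [← hx2.1, ← c.inv_edge, src_inv]
    subst hx
    have : p₁ = [] := c.isForest.eq_nil c.isSubgraph_collapsed hx1
      (List.IsChain.left_of_append hr.tail) fun d hd => c.proj_eq_none.1 (h1 d hd)
    subst this
    exact (List.isChain_cons_cons.1 hr).1 (c.inv_edge e).symm

/-- The gaps between consecutive lifted darts are bridged by reduced paths in the collapsed forest.
With `lift_unique`, reduced paths correspond bijectively; this carries markings across a contraction
in both directions. -/
theorem exists_lift (hq : H.IsPath (c.onV u) q (c.onV v)) (hr : H.IsReduced q) :
    ∃ p, G.IsPath u p v ∧ G.IsReduced p ∧ c.map p = q := by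
  induction q generalizing u with
  | nil =>
    obtain ⟨p, hp, hpr, hpc⟩ := ((c.onV_eq_iff u v).1 hq).exists_isReduced
    exact ⟨p, hp, hpr, c.map_eq_nil.2 hpc⟩
  | cons e q ih =>
    obtain ⟨he, hq⟩ := hq
    obtain ⟨p, hp, hpr, rfl⟩ := ih (u := G.tgt (c.edge e)) (by rwa [c.tgt_edge]) hr.tail
    obtain ⟨z, hz, hzr, hzc⟩ := ((c.onV_eq_iff u (G.src (c.edge e))).1
      (by rw [c.src_edge, he])).exists_isReduced
    refine ⟨z ++ c.edge e :: p, isPath_append.2 ⟨_, hz, rfl, hp⟩, ?_, ?_⟩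
    · refine List.isChain_append.2 ⟨hzr, ?_, ?_⟩
      · cases p with
        | nil => exact List.isChain_singleton _
        | cons a p =>
          refine List.isChain_cons_cons.2 ⟨?_, hpr⟩
          rintro rfl
          rw [c.inv_edge, map_cons_edge] at hr
          exact (List.isChain_cons_cons.1 hr).1 rfl
      · intro x hx y hy
        simp only [List.head?_cons, Option.mem_def, Option.some.injEq] at hy
        subst hy
        have hx : x ∈ c.collapsed := hzc x (List.mem_of_mem_getLast? hx)
        intro h
        exact c.edge_not_mem e (h ▸ c.isSubgraph_collapsed _ hx)
    · rw [map_append, map_cons_edge, c.map_eq_nil.2 hzc, List.nil_append]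

theorem lift_unique (hp : G.IsPath u p v) (hp' : G.IsPath u p' v) (hr : G.IsReduced p)
    (hr' : G.IsReduced p') (h : c.map p = c.map p') : p = p' := by
  induction hq : c.map p generalizing u p p' with
  | nil =>
    exact c.isForest.unique c.isSubgraph_collapsed hp hp' hr hr' (c.map_eq_nil.1 hq)
      (c.map_eq_nil.1 (h ▸ hq))
  | cons e q ih =>
    obtain ⟨z, a, r, rfl, h1, h2, h3⟩ := List.filterMap_eq_cons_iff.1 hq
    obtain ⟨z', a', r', rfl, h1', h2', h3'⟩ := List.filterMap_eq_cons_iff.1 (h.symm.trans hq)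
    obtain rfl := c.proj_eq_some.1 h2
    obtain rfl := c.proj_eq_some.1 h2'
    obtain ⟨x, hx1, rfl, hx2⟩ := isPath_append.1 hp
    obtain ⟨x', hx1', rfl, hx2'⟩ := isPath_append.1 hp'
    have hr2 := List.isChain_append.1 hr
    have hr2' := List.isChain_append.1 hr'
    rw [c.isForest.unique c.isSubgraph_collapsed hx1 hx1' hr2.1 hr2'.1
      (fun d hd => c.proj_eq_none.1 (h1 d hd)) (fun d hd => c.proj_eq_none.1 (h1' d hd)),
      ih hx2 hx2' hr2.2.1.tail hr2'.2.1.tail (h3.trans h3'.symm) h3]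

theorem joinedIn_iff (hA : c.collapsed ⊆ A) :
    H.JoinedIn (c.edge ⁻¹' A) (c.onV u) (c.onV v) ↔ G.JoinedIn A u v := by
  constructor
  · intro h
    obtain ⟨q, hq, hqr, hqA⟩ := h.exists_isReduced
    obtain ⟨p, hp, -, rfl⟩ := c.exists_lift hq hqr
    refine ⟨p, hp, fun d hd => ?_⟩
    by_cases hdc : d ∈ c.collapsed
    · exact hA hdc
    · obtain ⟨e, rfl⟩ := c.eq_edge_of_not_mem hdc
      exact hqA e (c.mem_map.2 hd)
  · rintro ⟨p, hp, hpA⟩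
    exact ⟨_, c.isPath_map hp, fun e he => hpA _ (c.mem_map.1 he)⟩

theorem isSeparatingIn_iff (hA : c.collapsed ⊆ A) :
    H.IsSeparatingIn (c.edge ⁻¹' A) e ↔ G.IsSeparatingIn A (c.edge e) := by
  unfold IsSeparatingIn
  have h1 : c.edge ⁻¹' A \ {e, H.inv e} = c.edge ⁻¹' (A \ {c.edge e, G.inv (c.edge e)}) := by
    ext a
    simp [c.inv_edge, c.edge_injective.eq_iff]
  rw [h1, ← c.src_edge, ← c.tgt_edge, c.joinedIn_iff]
  intro d hd
  refine ⟨hA hd, ?_⟩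
  rintro (rfl | rfl)
  · exact c.edge_not_mem e hd
  · rw [c.inv_edge] at hd
    exact c.edge_not_mem _ hd

theorem isSubgraph_preimage (hA : G.IsSubgraph A) : H.IsSubgraph (c.edge ⁻¹' A) := fun e he => by
  rw [mem_preimage, ← c.inv_edge]
  exact hA _ he

/-- A closed reduced path in `A` has a closed reduced image in a forest, which is empty; so the path
lies in the collapsed forest and is empty too. -/
theorem isForest_of_preimage (hA : G.IsSubgraph A) (hf : H.IsForest (c.edge ⁻¹' A)) :
    G.IsForest A := by
  refine isForest_of_eq_nil (fun u p hp hr hpA => ?_) hA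
  have h : c.map p = [] := hf.eq_nil (c.isSubgraph_preimage hA) (c.isPath_map hp)
    (c.isReduced_map hp hr) fun e he => hpA _ (c.mem_map.1 he)
  exact c.isForest.eq_nil c.isSubgraph_collapsed hp hr (c.map_eq_nil.1 h)

/-- The contraction of a graph onto itself. -/
def id (G : FinGraph) : Contraction G G where
  onV := fun v => v
  edge := fun d => d
  edge_injective _ _ h := h
  inv_edge _ := rfl
  src_edge _ := rfl
  onV_eq_iff u v := by
    constructor
    · rintro rfl
      exact JoinedIn.refl _ _
    · rintro ⟨p, hp, hpA⟩
      cases p with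
      | nil => exact hp
      | cons d p => exact (hpA d (by simp) ⟨d, rfl⟩).elim
  isForest d hd := (hd ⟨d, rfl⟩).elim

theorem range_comp_compl (c' : Contraction H K) :
    c.edge ⁻¹' (range fun e => c.edge (c'.edge e))ᶜ = c'.collapsed := by
  ext e
  simp [collapsed, c.edge_injective.eq_iff]

/-- The composition of two contractions. -/
def comp (c : Contraction G H) (c' : Contraction H K) : Contraction G K where
  onV v := c'.onV (c.onV v)
  edge e := c.edge (c'.edge e)
  edge_injective := c.edge_injective.comp c'.edge_injective
  inv_edge d := by rw [c.inv_edge, c'.inv_edge]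
  src_edge d := by rw [c.src_edge, c'.src_edge]
  onV_eq_iff u v := by
    rw [c'.onV_eq_iff, ← c.joinedIn_iff (A := (range fun e => c.edge (c'.edge e))ᶜ),
      range_comp_compl, collapsed]
    rintro d hd ⟨e, rfl⟩
    exact c.edge_not_mem _ hd
  isForest := by
    refine c.isForest_of_preimage ?_ ?_
    · rintro d hd ⟨e, he⟩
      exact hd ⟨K.inv e, by
        change c.edge (c'.edge _) = d
        change c.edge (c'.edge _) = _ at he
        rw [← c'.inv_edge, ← c.inv_edge, he, inv_inv']⟩
    · rw [range_comp_compl]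
      exact c'.isForest

end Contraction

/-! ### Quotient graphs -/

section Quotient

variable (G : FinGraph) {A : Set G.D} (hA : G.IsSubgraph A)

/-- The components of a subgraph. -/
def componentSetoid : Setoid G.V where
  r := G.JoinedIn A
  iseqv := ⟨JoinedIn.refl A, JoinedIn.symm hA, JoinedIn.trans⟩

/-- The graph obtained by collapsing each component of a subgraph to a point. -/
def quotient : FinGraph where
  V := Quotient (G.componentSetoid hA)
  D := {d // d ∉ A}
  fintypeV := @Quotient.fintype _ _ _ (Classical.decRel _)
  fintypeD := @Subtype.fintype _ _ (Classical.decPred _) _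
  src d := Quotient.mk _ (G.src d)
  inv d := ⟨G.inv d, fun h => d.2 (hA.inv_mem_iff.1 h)⟩
  inv_inv _ := Subtype.ext (G.inv_inv _)
  inv_ne _ h := G.inv_ne _ (congrArg Subtype.val h)

theorem range_val_compl : (range (Subtype.val : {d // d ∉ A} → G.D))ᶜ = A := by
  ext
  simp

/-- The contraction of a subforest. -/
def quotientContraction (hf : G.IsForest A) : Contraction G (G.quotient hA) where
  onV v := Quotient.mk _ v
  edge := Subtype.val
  edge_injective := Subtype.val_injective
  inv_edge _ := rfl
  src_edge _ := rfl
  onV_eq_iff u v := by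
    refine Quotient.eq.trans (iff_of_eq ?_)
    exact congrArg (G.JoinedIn · u v) (range_val_compl G).symm
  isForest := (congrArg G.IsForest (range_val_compl G)).mpr hf

theorem collapsed_quotientContraction (hf : G.IsForest A) :
    (G.quotientContraction hA hf).collapsed = A :=
  range_val_compl G

theorem three_le_valence_quotient (hf : G.IsForest A) (hG : ∀ v, 3 ≤ G.valence v)
    (x : (G.quotient hA).V) :
    3 ≤ (G.quotient hA).valence x := by
  obtain ⟨r, rfl⟩ := Quotient.exists_rep x
  let S : Set G.D := {a | a ∉ A ∧ G.JoinedIn A (G.src a) r}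
  have hS : (G.quotient hA).valence (Quotient.mk _ r) = S.ncard := by
    have : S = Subtype.val '' {d : (G.quotient hA).D | (G.quotient hA).src d = Quotient.mk _ r} := by
      ext a
      constructor
      · rintro ⟨h1, h2⟩
        exact ⟨⟨a, h1⟩, Quotient.sound h2, rfl⟩
      · rintro ⟨a, ha, rfl⟩
        exact ⟨a.2, Quotient.exact ha⟩
    rw [this, ncard_image_of_injective _ Subtype.val_injective]
    rfl
  rw [hS]
  by_cases h : ∃ d ∈ A, G.src d = r
  · obtain ⟨d, hd, rfl⟩ := h
    -- From one leaf `v` of the tree, following its only forest dart `e` leads to a second leaf `w`.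
    -- Each leaf contributes two darts outside the forest, so the collapsed vertex has valence at
    -- least four.
    obtain ⟨v, e, hv, -, he, hev, hv2⟩ := hf.exists_two hA hG hd
    obtain ⟨w, -, hw, hwv, -, -, hw2⟩ := hf.exists_two hA hG he
    have hvr : G.JoinedIn A v (G.src d) :=
      ((joinedIn_dart hd).trans (hv.mono sdiff_subset)).symm hA
    have hwr : G.JoinedIn A w (G.src d) := by
      refine JoinedIn.trans (JoinedIn.symm hA ?_) hvr
      rw [← hev]
      exact (joinedIn_dart he).trans (hw.mono sdiff_subset)
    have hsub : {a | G.src a = v ∧ a ∉ A} ∪ {a | G.src a = w ∧ a ∉ A} ⊆ S := by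
      rintro a (⟨rfl, ha⟩ | ⟨rfl, ha⟩)
      exacts [⟨ha, hvr⟩, ⟨ha, hwr⟩]
    have hdisj : Disjoint {a | G.src a = v ∧ a ∉ A} {a | G.src a = w ∧ a ∉ A} := by
      rw [Set.disjoint_left]
      rintro a ⟨rfl, -⟩ ⟨h, -⟩
      exact hwv (h.symm.trans hev.symm)
    have := ncard_le_ncard hsub (toFinite _)
    rw [ncard_union_eq hdisj (toFinite _) (toFinite _)] at this
    omega
  · push Not at h
    refine (hG r).trans (ncard_le_ncard ?_ (toFinite _))
    rintro a rfl
    exact ⟨fun ha => h a ha rfl, JoinedIn.refl _ _⟩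

end Quotient

theorem Contraction.connected {G H : FinGraph} (c : Contraction G H) (hG : G.Connected)
    (hc : Function.Surjective c.onV) : H.Connected := by
  obtain ⟨⟨v⟩, h⟩ := hG
  refine ⟨⟨c.onV v⟩, fun x y => ?_⟩
  obtain ⟨x, rfl⟩ := hc x
  obtain ⟨y, rfl⟩ := hc y
  exact (c.joinedIn_iff (A := univ) (subset_univ _)).2 (h x y)

theorem Contraction.connected' {G H : FinGraph} (c : Contraction G H) (hH : H.Connected)
    [Nonempty G.V] : G.Connected :=
  ⟨inferInstance, fun _ _ => (c.joinedIn_iff (A := univ) (subset_univ _)).1 (hH.2 _ _)⟩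

end FinGraph

/-! ### Markings and collapses -/

namespace FinGraph.Contraction

variable {G H : FinGraph} (c : Contraction G H) {M : Type*} [Group M] {f : G.D → M} {f' : H.D → M}
  {γ : G.V → M} {u v : G.V} {p : List G.D} {A : Set G.D}

theorem prod_map (h1 : ∀ e, f' e =
      γ (G.src (c.edge e)) * f (c.edge e) * (γ (G.tgt (c.edge e)))⁻¹)
    (h2 : ∀ d ∈ c.collapsed, γ (G.src d) * f d * (γ (G.tgt d))⁻¹ = 1) (h : G.IsPath u p v) :
    ((c.map p).map f').prod = γ u * (p.map f).prod * (γ v)⁻¹ := by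
  induction p generalizing u with
  | nil =>
    obtain rfl : u = v := h
    simp
  | cons d p ih =>
    obtain ⟨rfl, hp⟩ := h
    have ih := ih hp
    by_cases hd : d ∈ c.collapsed
    · have h2 := h2 d hd
      rw [mul_inv_eq_one] at h2
      rw [c.map_cons_collapsed hd, ih, List.map_cons, List.prod_cons, ← h2]
      group
    · obtain ⟨e, rfl⟩ := c.eq_edge_of_not_mem hd
      rw [map_cons_edge, List.map_cons, List.prod_cons, ih, h1, List.map_cons, List.prod_cons]
      group

theorem marking_of_source (h1 : ∀ e, f' e =
      γ (G.src (c.edge e)) * f (c.edge e) * (γ (G.tgt (c.edge e)))⁻¹)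
    (h2 : ∀ d ∈ c.collapsed, γ (G.src d) * f d * (γ (G.tgt d))⁻¹ = 1)
    (hc : Function.Surjective c.onV)
    (hG : ∀ v g, ∃! p, G.IsPath v p v ∧ G.IsReduced p ∧ (p.map f).prod = g) (x : H.V) (g : M) :
    ∃! p, H.IsPath x p x ∧ H.IsReduced p ∧ (p.map f').prod = g := by
  obtain ⟨v, rfl⟩ := hc x
  obtain ⟨p, ⟨hp, hr, hg⟩, hu⟩ := hG v ((γ v)⁻¹ * g * γ v)
  refine ⟨c.map p, ⟨c.isPath_map hp, c.isReduced_map hp hr, ?_⟩, ?_⟩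
  · rw [c.prod_map h1 h2 hp, hg]
    group
  · rintro q ⟨hq, hqr, rfl⟩
    obtain ⟨p', hp', hr', rfl⟩ := c.exists_lift hq hqr
    rw [hu p' ⟨hp', hr', ?_⟩]
    rw [c.prod_map h1 h2 hp']
    group

theorem marking_of_target (h1 : ∀ e, f' e =
      γ (G.src (c.edge e)) * f (c.edge e) * (γ (G.tgt (c.edge e)))⁻¹)
    (h2 : ∀ d ∈ c.collapsed, γ (G.src d) * f d * (γ (G.tgt d))⁻¹ = 1)
    (hH : ∀ v g, ∃! p, H.IsPath v p v ∧ H.IsReduced p ∧ (p.map f').prod = g) (v : G.V) (g : M) :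
    ∃! p, G.IsPath v p v ∧ G.IsReduced p ∧ (p.map f).prod = g := by
  obtain ⟨q, ⟨hq, hr, hg⟩, hu⟩ := hH (c.onV v) (γ v * g * (γ v)⁻¹)
  obtain ⟨p, hp, hpr, rfl⟩ := c.exists_lift hq hr
  refine ⟨p, ⟨hp, hpr, ?_⟩, ?_⟩
  · rw [c.prod_map h1 h2 hp] at hg
    simpa using hg
  · rintro p' ⟨hp', hpr', rfl⟩
    refine c.lift_unique hp' hp hpr' hpr (hu _ ⟨c.isPath_map hp', c.isReduced_map hp' hpr', ?_⟩)
    exact c.prod_map h1 h2 hp'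

theorem vol_extend (m : H.D → ℝ) (A : Set G.D) :
    G.vol (Function.extend c.edge m 0) A = H.vol m (c.edge ⁻¹' A) := by
  classical
  unfold vol
  congr 1
  rw [← Finset.sum_subset (Finset.subset_univ (Finset.univ.map ⟨c.edge, c.edge_injective⟩)),
    Finset.sum_map]
  · refine Finset.sum_congr rfl fun e _ => ?_
    simp [indicator, c.edge_injective.extend_apply]
  · intro d _ hd
    have hd : ¬ ∃ e, c.edge e = d := by simpa using hd
    simp [indicator, Function.extend_apply' _ _ _ hd]

end FinGraph.Contraction

/-- The gauge at a vertex is the inverse of the label of a path in the forest to a chosen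
representative of its component; by `IsForest.prod_eq` it does not depend on the path. -/
theorem FinGraph.IsForest.exists_gauge {G : FinGraph} {A : Set G.D} {M : Type*} [Group M]
    {f : G.D → M} (hf : ∀ d, f (G.inv d) = (f d)⁻¹) (hA : G.IsSubgraph A) (h : G.IsForest A) :
    ∃ γ : G.V → M, ∀ d ∈ A, γ (G.src d) * f d * (γ (G.tgt d))⁻¹ = 1 := by
  let s := G.componentSetoid hA
  have hr : ∀ v, ∃ p, G.IsPath v p (Quotient.mk s v).out ∧ ∀ d ∈ p, d ∈ A := fun v =>
    JoinedIn.symm hA (Quotient.mk_out (s := s) v)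
  choose p hp hpA using hr
  refine ⟨fun v => ((p v).map f).prod⁻¹, fun d hd => ?_⟩
  have hs : Quotient.mk s (G.src d) = Quotient.mk s (G.tgt d) := Quotient.sound (joinedIn_dart hd)
  have := h.prod_eq hf hA (hp (G.src d)) (q := d :: p (G.tgt d)) ⟨rfl, by rw [hs]; exact hp _⟩
    (hpA _) (fun a ha => by
      rcases List.mem_cons.1 ha with rfl | ha
      exacts [hd, hpA _ _ ha])
  simp only [this, List.map_cons, List.prod_cons]
  group

namespace MarkedGraph

variable {n : ℕ} {G H K : MarkedGraph n}

theorem exists_dart (G : MarkedGraph n) (v : G.V) : ∃ d, G.src d = v := by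
  have := G.three_le_valence v
  obtain ⟨d, hd⟩ := nonempty_of_ncard_ne_zero (s := {d | G.src d = v}) (by
    unfold FinGraph.valence at this
    omega)
  exact ⟨d, hd⟩

namespace Collapse

/-- The underlying map of graphs. -/
def contraction (c : G.Collapse H) : FinGraph.Contraction G.toFinGraph H.toFinGraph where
  onV := c.onV
  edge := c.edge
  edge_injective := c.edge_injective
  inv_edge := c.inv_edge
  src_edge := c.src_edge
  onV_eq_iff := c.onV_eq_iff
  isForest := c.isForest

theorem onV_surjective (c : G.Collapse H) : Function.Surjective c.onV :=
  c.contraction.onV_surjective H.exists_dart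

/-- A contraction with compatible labels is a collapse. -/
def ofContraction (c : FinGraph.Contraction G.toFinGraph H.toFinGraph) (γ : G.V → F n)
    (h1 : ∀ e, H.label e = γ (G.src (c.edge e)) * G.label (c.edge e) * (γ (G.tgt (c.edge e)))⁻¹)
    (h2 : ∀ d ∈ c.collapsed, γ (G.src d) * G.label d * (γ (G.tgt d))⁻¹ = 1) : G.Collapse H where
  onV := c.onV
  edge := c.edge
  edge_injective := c.edge_injective
  inv_edge := c.inv_edge
  src_edge := c.src_edge
  onV_eq_iff := c.onV_eq_iff
  isForest := c.isForest
  gauge := γ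
  label_edge := h1
  label_collapsed := h2

/-- A marked graph as a collapse of itself. -/
def id (G : MarkedGraph n) : G.Collapse G :=
  ofContraction (FinGraph.Contraction.id _) (fun _ => 1)
    (fun e => by simp [FinGraph.Contraction.id]) (fun d hd => (hd ⟨d, rfl⟩).elim)

/-- The composition of two collapses. -/
def comp (c : G.Collapse H) (c' : H.Collapse K) : G.Collapse K :=
  ofContraction (c.contraction.comp c'.contraction) (fun v => c'.gauge (c.onV v) * c.gauge v)
    (fun e => by
      change K.label e = c'.gauge (c.onV (G.src (c.edge (c'.edge e)))) *
        c.gauge (G.src (c.edge (c'.edge e))) * G.label (c.edge (c'.edge e)) *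
        (c'.gauge (c.onV (G.tgt (c.edge (c'.edge e)))) * c.gauge (G.tgt (c.edge (c'.edge e))))⁻¹
      have := c.contraction.tgt_edge (c'.edge e)
      change c.onV (G.tgt (c.edge (c'.edge e))) = _ at this
      rw [c'.label_edge, c.label_edge, c.src_edge, this]
      group)
    (fun d hd => by
      by_cases hdc : d ∈ c.contraction.collapsed
      · have h1 := c.label_collapsed d hdc
        have h2 : c.onV (G.src d) = c.onV (G.tgt d) := c.contraction.onV_src_eq_tgt hdc
        rw [mul_inv_eq_one] at h1 ⊢
        rw [mul_assoc, h1, h2]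
      · obtain ⟨e, rfl⟩ := c.contraction.eq_edge_of_not_mem hdc
        have h1 := c'.label_collapsed e (fun ⟨a, ha⟩ => hd ⟨a, congrArg c.edge ha⟩)
        have h2 := c.contraction.tgt_edge e
        change c.onV (G.tgt (c.edge e)) = _ at h2
        change c'.gauge (c.onV (G.src (c.edge e))) * c.gauge (G.src (c.edge e)) *
          G.label (c.edge e) *
          (c'.gauge (c.onV (G.tgt (c.edge e))) * c.gauge (G.tgt (c.edge e)))⁻¹ = 1
        rw [c.label_edge] at h1
        rw [h2, c.src_edge, ← h1]
        group)

/-- An isomorphism of marked graphs is a collapse. -/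
def ofIso (i : G.Iso H) : G.Collapse H :=
  have hr : (range (i.onD.symm : H.D → G.D))ᶜ = ∅ := by simp
  ofContraction
    { onV := i.onV
      edge := i.onD.symm
      edge_injective := i.onD.symm.injective
      inv_edge := fun d => by
        rw [Equiv.eq_symm_apply, ← i.inv_onD, Equiv.apply_symm_apply]
      src_edge := fun d => by
        rw [← i.src_onD, Equiv.apply_symm_apply]
      onV_eq_iff := fun u v => by
        rw [hr, i.onV.injective.eq_iff]
        constructor
        · rintro rfl
          exact FinGraph.JoinedIn.refl _ _
        · rintro ⟨p, hp, hpA⟩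
          cases p with
          | nil => exact hp
          | cons d p => exact (hpA d (by simp)).elim
      isForest := by
        rw [hr]
        exact FinGraph.isForest_empty } i.gauge
    (fun e => by rw [← i.label_onD, Equiv.apply_symm_apply])
    (fun d hd => (hd ⟨i.onD d, by simp⟩).elim)

/-- Changing the markings in a collapse. -/
def twist (a : MulAut (F n)) (c : G.Collapse H) : (G.twist a).Collapse (H.twist a) :=
  ofContraction (G := G.twist a) (H := H.twist a) c.contraction (fun v => a (c.gauge v))
    (fun e => by
      refine (congrArg a (c.label_edge e)).trans ?_
      rw [map_mul, map_mul, map_inv]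
      rfl)
    (fun d hd => by
      refine Eq.trans ?_ ((congrArg a (c.label_collapsed d hd)).trans (map_one a))
      rw [map_mul, map_mul, map_inv]
      rfl)

/-- Collapsing a subforest determines the resulting marked graph. -/
theorem exists_iso (c : G.Collapse H) (c' : G.Collapse K) (h : range c.edge = range c'.edge) :
    ∃ i : H.Iso K, ∀ e, c'.edge (i.onD e) = c.edge e := by
  let E : H.D ≃ K.D := (Equiv.ofInjective _ c.edge_injective).trans
    ((Equiv.setCongr h).trans (Equiv.ofInjective _ c'.edge_injective).symm)
  have hE : ∀ e, c'.edge (E e) = c.edge e := fun e =>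
    congrArg Subtype.val ((Equiv.ofInjective _ c'.edge_injective).apply_symm_apply
      ((Equiv.setCongr h) (Equiv.ofInjective _ c.edge_injective e)))
  have hV : ∀ u v, c.onV u = c.onV v ↔ c'.onV u = c'.onV v := fun u v => by
    rw [c.onV_eq_iff, c'.onV_eq_iff, h]
  choose r hr using c.onV_surjective
  let V : H.V ≃ K.V := Equiv.ofBijective (fun x => c'.onV (r x))
    ⟨fun x y hxy => by rw [← hr x, ← hr y]; exact (hV _ _).2 hxy, fun y => by
      obtain ⟨u, rfl⟩ := c'.onV_surjective y
      exact ⟨c.onV u, (hV _ _).1 (hr _)⟩⟩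
  have hVr : ∀ u, V (c.onV u) = c'.onV u := fun u => (hV _ _).1 (hr _)
  -- The ratio of the two gauges is constant along collapsed darts, so it descends to a gauge on
  -- `H`.
  have hgauge : ∀ u v, c.onV u = c.onV v →
      c'.gauge u * (c.gauge u)⁻¹ = c'.gauge v * (c.gauge v)⁻¹ := by
    intro u v huv
    obtain ⟨p, hp, hpA⟩ := (c.onV_eq_iff u v).1 huv
    clear huv
    induction p generalizing u with
    | nil =>
      obtain rfl : u = v := hp
      rfl
    | cons d p ih =>
      obtain ⟨rfl, hp⟩ := hp
      rw [← ih _ hp fun a ha => hpA a (by simp [ha])]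
      have h1 := c.label_collapsed d (hpA d (by simp))
      have h2 := c'.label_collapsed d (h ▸ hpA d (by simp))
      rw [mul_inv_eq_one] at h1 h2
      rw [← h1, ← h2]
      group
  refine ⟨⟨V, E, fun e => ?_, fun e => ?_, fun x => c'.gauge (r x) * (c.gauge (r x))⁻¹,
    fun e => ?_⟩, hE⟩
  · rw [← c.src_edge, hVr, ← c'.src_edge, hE]
  · exact c'.edge_injective (by rw [← c'.inv_edge, hE, hE, c.inv_edge])
  · have h1 := hgauge (r (H.src e)) (G.src (c.edge e)) (by rw [hr, c.src_edge])
    have h2 := hgauge (r (H.tgt e)) (G.tgt (c.edge e)) (by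
      rw [hr]
      exact (c.contraction.tgt_edge e).symm)
    rw [h1, h2, c'.label_edge, c.label_edge, hE]
    group

end Collapse

/-- Every subforest can be collapsed. -/
theorem exists_collapse (G : MarkedGraph n) {A : Set G.D} (hA : G.IsSubgraph A)
    (hf : G.IsForest A) : ∃ (H : MarkedGraph n) (c : G.Collapse H), (range c.edge)ᶜ = A := by
  obtain ⟨γ, hγ⟩ := hf.exists_gauge G.label_inv hA
  let c := G.toFinGraph.quotientContraction hA hf
  have hc : c.collapsed = A := G.toFinGraph.collapsed_quotientContraction hA hf
  have hs : Function.Surjective c.onV := Quotient.mk_surjective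
  let lab : (G.toFinGraph.quotient hA).D → F n := fun e =>
    γ (G.src (c.edge e)) * G.label (c.edge e) * (γ (G.tgt (c.edge e)))⁻¹
  have h2 : ∀ d ∈ c.collapsed, γ (G.src d) * G.label d * (γ (G.tgt d))⁻¹ = 1 :=
    fun d hd => hγ d (hc ▸ hd)
  let H : MarkedGraph n :=
    { toFinGraph := G.toFinGraph.quotient hA
      connected := c.connected G.connected hs
      three_le_valence := G.toFinGraph.three_le_valence_quotient hA hf G.three_le_valence
      label := lab
      label_inv := fun e => by
        simp only [lab, ← c.inv_edge, G.label_inv, FinGraph.src_inv, FinGraph.tgt_inv]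
        group
      marking := c.marking_of_source (fun _ => rfl) h2 hs G.marking }
  exact ⟨H, Collapse.ofContraction (H := H) c γ (fun _ => rfl) h2, hc⟩

end MarkedGraph

/-! ### Points of closed cells -/

theorem FinGraph.vol_eq_zero_iff {G : FinGraph} {m : G.D → ℝ} (hm : ∀ d, 0 ≤ m d) {A : Set G.D} :
    G.vol m A = 0 ↔ ∀ d ∈ A, m d = 0 := by
  unfold vol
  rw [div_eq_zero_iff, Finset.sum_eq_zero_iff_of_nonneg fun d _ => indicator_nonneg (fun d _ => hm d) d]
  simp

namespace ClosedCell

variable {n : ℕ} {G H : MarkedGraph n}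

/-- A point as a point of the closed cell of its graph. -/
def self (x : Point n) : ClosedCell x.graph := ⟨x, .id _⟩

@[simp] theorem metric_self (x : Point n) : (self x).metric = x.m := by
  funext i d
  exact Function.Injective.extend_apply (f := (fun d => d : x.graph.D → x.graph.D))
    (fun _ _ h => h) (x.m i) 0 d

/-- The inclusion of the closed cell of a collapse of `G` in the closed cell of `G`. -/
def pullback (c : G.Collapse H) (z : ClosedCell H) : ClosedCell G := ⟨z.1, c.comp z.2⟩

theorem metric_edge (z : ClosedCell G) (i : ℕ) (e : z.1.graph.D) :
    z.metric i (z.2.edge e) = z.1.m i e :=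
  z.2.edge_injective.extend_apply _ _ _

theorem metric_collapsed (z : ClosedCell G) (i : ℕ) {d : G.D} (hd : d ∉ range z.2.edge) :
    z.metric i d = 0 :=
  Function.extend_apply' _ _ _ hd

theorem metric_pullback_edge (c : G.Collapse H) (z : ClosedCell H) (i : ℕ) (e : H.D) :
    (pullback c z).metric i (c.edge e) = z.metric i e := by
  by_cases he : e ∈ range z.2.edge
  · obtain ⟨e, rfl⟩ := he
    rw [metric_edge]
    exact metric_edge (pullback c z) i e
  · rw [metric_collapsed z i he]
    refine metric_collapsed (pullback c z) i ?_
    rintro ⟨a, ha⟩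
    exact he ⟨a, c.edge_injective ha⟩

theorem metric_pullback (c : G.Collapse H) (z : ClosedCell H) (i : ℕ) :
    (pullback c z).metric i = Function.extend c.edge (z.metric i) 0 := by
  funext d
  by_cases hd : d ∈ range c.edge
  · obtain ⟨e, rfl⟩ := hd
    rw [metric_pullback_edge, c.edge_injective.extend_apply]
  · rw [Function.extend_apply' _ _ _ hd]
    refine metric_collapsed (pullback c z) i ?_
    rintro ⟨a, ha⟩
    exact hd ⟨_, ha⟩

theorem metric_nonneg (z : ClosedCell G) (i : ℕ) (d : G.D) : 0 ≤ z.metric i d := by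
  by_cases hd : d ∈ range z.2.edge
  · obtain ⟨e, rfl⟩ := hd
    rw [metric_edge]
    exact z.1.m_nonneg i e
  · rw [metric_collapsed z i hd]

theorem vol_metric (z : ClosedCell G) (i : ℕ) (A : Set G.D) :
    G.vol (z.metric i) A = z.1.graph.vol (z.1.m i) (z.2.edge ⁻¹' A) :=
  z.2.contraction.vol_extend _ _

theorem range_edge (z : ClosedCell G) : range z.2.edge = {d | ∃ i, z.metric i d ≠ 0} := by
  ext d
  constructor
  · rintro ⟨e, rfl⟩
    obtain ⟨i, hi, -⟩ := z.1.nondegenerate e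
    exact ⟨i, by rwa [metric_edge]⟩
  · rintro ⟨i, hi⟩
    by_contra hd
    exact hi (metric_collapsed z i hd)

theorem le_depth_iff (z : ClosedCell G) (i : ℕ) : i ≤ z.1.depth ↔ G.vol (z.metric i) univ ≠ 0 := by
  rw [vol_metric, preimage_univ]
  constructor
  · intro h
    rw [z.1.vol_eq_one i h]
    exact one_ne_zero
  · intro h
    rw [Ne, FinGraph.vol_eq_zero_iff (z.1.m_nonneg i)] at h
    push Not at h
    obtain ⟨d, -, hd⟩ := h
    exact z.1.le_depth i d hd

theorem vol_metric_univ (z : ClosedCell G) {i : ℕ} (hi : i ≤ z.1.depth) :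
    G.vol (z.metric i) univ = 1 := by
  rw [vol_metric, preimage_univ, z.1.vol_eq_one i hi]

/-- A point of a closed cell is determined by its metrics. -/
theorem equivalent_of_metric_eq (z z' : ClosedCell G) (hm : z.metric = z'.metric) :
    z.1.Equivalent z'.1 := by
  have hd : z.1.depth = z'.1.depth := eq_of_forall_le_iff fun i => by
    rw [le_depth_iff, le_depth_iff, hm]
  obtain ⟨i, hi⟩ := z.2.exists_iso z'.2 (by rw [range_edge, range_edge, hm])
  refine ⟨i, hd, fun j e => ?_⟩
  rw [← metric_edge, hi, ← hm, metric_edge]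

/-- Points are built from metrics on a fixed graph `G` in which some edges may have length zero in
all of them; these edges are collapsed. The core condition is needed only for the edges that
survive. -/
theorem exists_of_metric (G : MarkedGraph n) (k : ℕ) (m : ℕ → G.D → ℝ)
    (m_nonneg : ∀ i d, 0 ≤ m i d) (m_inv : ∀ i d, m i (G.inv d) = m i d)
    (unique : ∀ d i j, m i d ≠ 0 → m j d ≠ 0 → i = j) (le_depth : ∀ i d, m i d ≠ 0 → i ≤ k)
    (vol_eq_one : ∀ i ≤ k, G.vol (m i) univ = 1)
    (forest : G.IsForest {d | ∀ i, m i d = 0})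
    (core : ∀ i, 1 ≤ i → i ≤ k → ∀ d, (∀ j < i, m j d = 0) → (∃ j, m j d ≠ 0) →
      ¬ G.IsSeparatingIn {d | ∀ j < i, m j d = 0} d) :
    ∃ z : ClosedCell G, z.1.depth = k ∧ z.metric = m := by
  have hsub : G.IsSubgraph {d | ∀ i, m i d = 0} := fun d hd i => (m_inv i d).trans (hd i)
  obtain ⟨H, c, hc⟩ := G.exists_collapse hsub forest
  have hce : ∀ e, ∃ i, m i (c.edge e) ≠ 0 := fun e => by
    have : c.edge e ∉ {d | ∀ i, m i d = 0} := by
      rw [← hc]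
      exact fun h => h ⟨e, rfl⟩
    simpa using this
  have hext : ∀ i, Function.extend c.edge (fun e => m i (c.edge e)) 0 = m i := fun i => by
    funext d
    by_cases hd : d ∈ range c.edge
    · obtain ⟨e, rfl⟩ := hd
      rw [c.edge_injective.extend_apply]
    · rw [Function.extend_apply' _ _ _ hd]
      have : d ∈ {d | ∀ i, m i d = 0} := hc ▸ hd
      exact (this i).symm
  refine ⟨⟨⟨H, k, fun i e => m i (c.edge e), fun i e => m_nonneg _ _, fun i e => ?_, fun e => ?_,
    fun i e => le_depth _ _, fun i hi => ?_, fun i hi hik => ?_⟩, c⟩, rfl, funext hext⟩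
  · rw [← c.inv_edge, m_inv]
  · obtain ⟨i, hi⟩ := hce e
    exact ⟨i, hi, fun j hj => unique _ _ _ hj hi⟩
  · have := c.contraction.vol_extend (fun e => m i (c.edge e)) univ
    change G.vol (Function.extend c.edge (fun e => m i (c.edge e)) 0) univ = _ at this
    rw [hext, vol_eq_one i hi] at this
    exact this.symm
  · let A : Set G.D := {d | ∀ j < i, m j d = 0}
    have hA : G.IsSubgraph A := fun d hd j hj => (m_inv j d).trans (hd j hj)
    have hcA : c.contraction.collapsed ⊆ A := fun d hd j _ => by
      have : d ∈ {d | ∀ i, m i d = 0} := hc ▸ hd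
      exact this j
    refine FinGraph.isCore_iff.2 ⟨c.contraction.isSubgraph_preimage hA, fun e he h => ?_⟩
    exact core i hi hik (c.edge e) he (hce e) ((c.contraction.isSeparatingIn_iff hcA).1 h)

end ClosedCell

/-! ### The maximal core subgraph -/

namespace FinGraph

variable {G : FinGraph} {A B : Set G.D} {u v : G.V} {d : G.D}

theorem IsForest.mono (h : G.IsForest B) (hAB : A ⊆ B) : G.IsForest A :=
  fun d hd => (h d (hAB hd)).mono hAB

/-- Joined vertices are joined by an edge path that uses each edge at most once. -/
theorem JoinedIn.exists_simple (h : G.JoinedIn A u v) : ∃ p, G.IsPath u p v ∧ (∀ d ∈ p, d ∈ A) ∧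
    ∀ p₁ e p₂, p = p₁ ++ e :: p₂ → e ∉ p₁ ∧ G.inv e ∉ p₁ ∧ e ∉ p₂ ∧ G.inv e ∉ p₂ := by
  classical
  have hex : ∃ k p, p.length = k ∧ G.IsPath u p v ∧ ∀ d ∈ p, d ∈ A := by
    obtain ⟨p, hp⟩ := h
    exact ⟨_, p, rfl, hp⟩
  obtain ⟨p, hk, hp, hpA⟩ := Nat.find_spec hex
  have hmin : ∀ q, G.IsPath u q v → (∀ d ∈ q, d ∈ p) → p.length ≤ q.length := fun q hq hqp => by
    rw [hk]
    exact Nat.find_min' hex ⟨q, rfl, hq, fun d hd => hpA d (hqp d hd)⟩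
  refine ⟨p, hp, hpA, ?_⟩
  rintro p₁ e p₂ rfl
  obtain ⟨x, h1, rfl, h2⟩ := isPath_append.1 hp
  refine ⟨fun he => ?_, fun he => ?_, fun he => ?_, fun he => ?_⟩ <;>
    obtain ⟨q₁, q₂, rfl⟩ := List.append_of_mem he
  · obtain ⟨y, h3, rfl, h4⟩ := isPath_append.1 h1
    have := hmin (q₁ ++ e :: p₂) (isPath_append.2 ⟨_, h3, rfl, h2⟩) (by simp; tauto)
    simp at this
    omega
  · obtain ⟨y, h3, rfl, h4⟩ := isPath_append.1 h1
    have := hmin (q₁ ++ p₂) (isPath_append.2 ⟨_, h3, h2⟩) (by simp; tauto)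
    simp at this
    omega
  · obtain ⟨y, h3, rfl, h4⟩ := isPath_append.1 h2
    have := hmin (p₁ ++ e :: q₂) (isPath_append.2 ⟨_, h1, rfl, h4⟩) (by simp; tauto)
    simp at this
    omega
  · obtain ⟨y, h3, rfl, h4⟩ := isPath_append.1 h2
    rw [tgt_inv] at h4
    have := hmin (p₁ ++ q₂) (isPath_append.2 ⟨_, h1, h4⟩) (by simp; tauto)
    simp at this
    omega

/-- The maximal core subgraph: the edges that do not separate. -/
def core (G : FinGraph) : Set G.D := {d | ¬ G.IsSeparatingIn univ d}

theorem isSubgraph_core : G.IsSubgraph G.core := fun _ hd h =>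
  hd ((isSeparatingIn_inv isSubgraph_univ).1 h)

theorem isForest_compl_core : G.IsForest G.coreᶜ := fun _ hd =>
  (not_not.1 hd).mono (subset_univ _)

theorem IsCore.subset_core (h : G.IsCore A) : A ⊆ G.core :=
  fun d hd hs => h.not_separating d hd (hs.mono (subset_univ _))

theorem isCore_core : G.IsCore G.core := by
  refine isCore_iff.2 ⟨isSubgraph_core, fun d hd => not_not.2 ?_⟩
  obtain ⟨p, hp, hpA, hs⟩ := (not_not.1 hd : G.JoinedIn _ _ _).exists_simple
  refine ⟨p, hp, fun e he => ⟨fun hes => ?_, (hpA e he).2⟩⟩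
  obtain ⟨p₁, p₂, rfl⟩ := List.append_of_mem he
  obtain ⟨h1, h2, h3, h4⟩ := hs _ _ _ rfl
  obtain ⟨x, hp1, rfl, hp2⟩ := isPath_append.1 hp
  -- The edge of `d` and the simple path `p` form a cycle. Going round it the other way joins the
  -- ends of `e` without `e`, so the whole cycle consists of nonseparating edges.
  have hpath : G.IsPath (G.tgt e) (p₂ ++ G.inv d :: p₁) (G.src e) :=
    isPath_append.2 ⟨_, hp2, rfl, by rwa [tgt_inv]⟩
  refine hes (JoinedIn.symm (isSubgraph_univ.diff_edge e) ⟨_, hpath, fun a ha => ⟨trivial, ?_⟩⟩)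
  have hde : G.inv d ≠ e ∧ G.inv d ≠ G.inv e := by
    have := (hpA e he).2
    refine ⟨fun h => this (Or.inr h.symm), fun h => this (Or.inl ?_)⟩
    simpa using (congrArg G.inv h).symm
  simp only [List.mem_append, List.mem_cons] at ha
  rintro (rfl | rfl)
  · rcases ha with ha | ha | ha
    exacts [h3 ha, hde.1 ha.symm, h1 ha]
  · rcases ha with ha | ha | ha
    exacts [h4 ha, hde.2 ha.symm, h2 ha]

theorem core_eq_univ_iff : G.core = univ ↔ ¬ G.HasSeparatingEdge := by
  simp [core, HasSeparatingEdge, eq_univ_iff_forall]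

theorem Contraction.preimage_core {H : FinGraph} (c : Contraction G H) :
    c.edge ⁻¹' G.core = H.core := by
  ext e
  exact not_congr (c.isSeparatingIn_iff (A := univ) (subset_univ _)).symm

/-! ### The flow on metrics -/

/-- The first metric that does not vanish on the maximal core subgraph. -/
def coreLevel (G : FinGraph) (m : ℕ → G.D → ℝ) : ℕ := sInf {i | G.vol (m i) G.core ≠ 0}

open Classical in
/-- The number of metrics that are lost at time `t`. -/
def shift (G : FinGraph) (m : ℕ → G.D → ℝ) (t : ℝ) : ℕ := if t = 0 then 0 else G.coreLevel m

/-- The flow on sequences of metrics: the first metric moves linearly to the normalized metric on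
the maximal core subgraph. -/
def flow (G : FinGraph) (m : ℕ → G.D → ℝ) (t : ℝ) : ℕ → G.D → ℝ
  | 0 => fun d => (1 - t) * m 0 d +
      t * (G.core.indicator (m (G.coreLevel m)) d / G.vol (m (G.coreLevel m)) G.core)
  | i + 1 => m (i + 1 + G.shift m t)

theorem flow_at_zero (m : ℕ → G.D → ℝ) : G.flow m 0 = m := by
  funext i
  cases i with
  | zero =>
    funext d
    simp [flow]
  | succ i => simp [flow, shift]

theorem vol_smul_add (a b : ℝ) (m m' : G.D → ℝ) (A : Set G.D) :
    G.vol (fun d => a * m d + b * m' d) A = a * G.vol m A + b * G.vol m' A := by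
  unfold vol
  have : ∀ d, A.indicator (fun d => a * m d + b * m' d) d =
      a * A.indicator m d + b * A.indicator m' d := fun d => by
    by_cases hd : d ∈ A <;> simp [hd]
  simp only [this, Finset.sum_add_distrib, ← Finset.mul_sum]
  ring

theorem vol_congr {m m' : G.D → ℝ} (h : ∀ d ∈ A, m d = m' d) : G.vol m A = G.vol m' A := by
  unfold vol
  rw [indicator_congr h]

theorem vol_const_mul (a : ℝ) (m : G.D → ℝ) (A : Set G.D) :
    G.vol (fun d => a * m d) A = a * G.vol m A := by
  simpa using vol_smul_add a 0 m m A

theorem vol_indicator_univ (m : G.D → ℝ) (A : Set G.D) :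
    G.vol (A.indicator m) univ = G.vol m A := by
  simp [vol]

theorem vol_nonneg {m : G.D → ℝ} (hm : ∀ d, 0 ≤ m d) (A : Set G.D) : 0 ≤ G.vol m A :=
  div_nonneg (Finset.sum_nonneg fun _ _ => indicator_nonneg (fun d _ => hm d) _) zero_le_two

theorem vol_flow_zero (m : ℕ → G.D → ℝ) (t : ℝ) (h : G.vol (m (G.coreLevel m)) G.core ≠ 0) :
    G.vol (G.flow m t 0) univ = (1 - t) * G.vol (m 0) univ + t := by
  have : G.flow m t 0 = fun d => (1 - t) * m 0 d + (t / G.vol (m (G.coreLevel m)) G.core) *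
      G.core.indicator (m (G.coreLevel m)) d := by
    funext d
    simp only [flow]
    ring
  rw [this, vol_smul_add, vol_indicator_univ, div_mul_cancel₀ _ h]

/-- Rescaling the metrics on a subgraph does not change the normalized metric. -/
theorem normalized_eq (m m' : ℕ → G.D → ℝ) (s : ℕ) (a : ℕ → ℝ) (ha : ∀ i, a i ≠ 0)
    (h : ∀ i, ∀ d ∈ A, m' i d = a i * m (i + s) d) (h0 : ∀ j < s, ∀ d ∈ A, m j d = 0)
    (hd : d ∈ A) :
    m' (sInf {i | G.vol (m' i) A ≠ 0}) d / G.vol (m' (sInf {i | G.vol (m' i) A ≠ 0})) A =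
      m (sInf {i | G.vol (m i) A ≠ 0}) d / G.vol (m (sInf {i | G.vol (m i) A ≠ 0})) A := by
  have hv : ∀ i, G.vol (m' i) A = a i * G.vol (m (i + s)) A := fun i => by
    rw [vol_congr (h i), vol_const_mul]
  have hs : {i | G.vol (m' i) A ≠ 0} = {i | G.vol (m (i + s)) A ≠ 0} := by
    ext i
    simp [hv, ha]
  have hz : ∀ j < s, G.vol (m j) A = 0 := fun j hj => by
    rw [vol_congr (h0 j hj)]
    simp [vol]
  by_cases hne : {i | G.vol (m i) A ≠ 0}.Nonempty
  · have hle : s ≤ sInf {i | G.vol (m i) A ≠ 0} := by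
      refine le_csInf hne fun j hj => ?_
      by_contra hjs
      exact hj (hz j (not_le.1 hjs))
    rw [← Nat.sInf_add hle, hs, h _ d hd, hv]
    exact mul_div_mul_left _ _ (ha _)
  · have h1 : ∀ i, G.vol (m i) A = 0 := by
      intro i
      by_contra hi
      exact hne ⟨i, hi⟩
    simp [hv, h1]

end FinGraph

/-- The separating edges form a forest, and by the valence condition a leaf of a forest carries
darts outside of it. -/
theorem MarkedGraph.core_nonempty {n : ℕ} (G : MarkedGraph n) : G.core.Nonempty := by
  obtain ⟨v⟩ := G.connected.1
  obtain ⟨d, -⟩ := G.exists_dart v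
  by_cases hd : d ∈ G.core
  · exact ⟨d, hd⟩
  obtain ⟨v, e, -, -, -, -, h⟩ := FinGraph.isForest_compl_core.exists_two
    FinGraph.isSubgraph_core.compl G.three_le_valence hd
  obtain ⟨a, ha⟩ := nonempty_of_ncard_ne_zero (s := {a | G.src a = v ∧ a ∉ G.coreᶜ}) (by omega)
  exact ⟨a, not_not.1 ha.2⟩

/-! ### The flow on representatives -/

namespace Point

variable {n : ℕ} (x : Point n)

/-- An edge of zero length in the first metric lies in Γ_1, which is a core subgraph and hence
contained in the maximal one. -/
theorem m_zero_ne_zero {d : x.graph.D} (hd : d ∉ x.graph.core) : x.m 0 d ≠ 0 := by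
  intro h0
  obtain ⟨i, hi, -⟩ := x.nondegenerate d
  have hi0 : i ≠ 0 := by
    rintro rfl
    exact hi h0
  have := x.isCore 1 le_rfl ((Nat.one_le_iff_ne_zero.2 hi0).trans (x.le_depth i d hi))
  exact hd (this.subset_core (a := d) (by simpa using h0))

theorem eq_zero_of_ne {d : x.graph.D} {i j : ℕ} (hi : x.m i d ≠ 0) (hij : i ≠ j) :
    x.m j d = 0 := by
  by_contra hj
  exact hij ((x.nondegenerate d).unique hi hj)

theorem vol_coreLevel_ne_zero : x.graph.vol (x.m (x.graph.coreLevel x.m)) x.graph.core ≠ 0 := by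
  obtain ⟨d, hd⟩ := x.graph.core_nonempty
  obtain ⟨i, hi, -⟩ := x.nondegenerate d
  exact Nat.sInf_mem (s := {i | x.graph.vol (x.m i) x.graph.core ≠ 0})
    ⟨i, fun h => hi ((FinGraph.vol_eq_zero_iff (x.m_nonneg i)).1 h d hd)⟩

theorem eq_zero_of_lt_coreLevel {j : ℕ} (hj : j < x.graph.coreLevel x.m) {d : x.graph.D}
    (hd : d ∈ x.graph.core) : x.m j d = 0 := by
  have := Nat.notMem_of_lt_sInf hj
  exact (FinGraph.vol_eq_zero_iff (x.m_nonneg j)).1 (not_not.1 this) d hd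

theorem coreLevel_le_depth : x.graph.coreLevel x.m ≤ x.depth := by
  have := x.vol_coreLevel_ne_zero
  rw [Ne, FinGraph.vol_eq_zero_iff (x.m_nonneg _)] at this
  push Not at this
  obtain ⟨d, -, hd⟩ := this
  exact x.le_depth _ d hd

/-- If both m_0 and m_1 vanished on the maximal core, m_1 would be zero everywhere, as m_0 is
already positive on the separating edges. This contradicts its volume being one. -/
theorem coreLevel_le_one : x.graph.coreLevel x.m ≤ 1 := by
  by_contra h
  push Not at h
  have h1 := x.vol_eq_one 1 (h.le.trans x.coreLevel_le_depth)
  have h2 : x.graph.vol (x.m 1) univ = 0 := by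
    refine (FinGraph.vol_eq_zero_iff (x.m_nonneg 1)).2 fun d _ => ?_
    by_cases hd : d ∈ x.graph.core
    · exact x.eq_zero_of_lt_coreLevel h hd
    · exact x.eq_zero_of_ne (x.m_zero_ne_zero hd) zero_ne_one
  rw [h1] at h2
  exact one_ne_zero h2

theorem flow_zero_eq_zero {t : ℝ} (ht : 0 < t) (ht1 : t ≤ 1) {d : x.graph.D}
    (h : x.graph.flow x.m t 0 d = 0) (hd : d ∈ x.graph.core) :
    x.m (x.graph.coreLevel x.m) d = 0 := by
  have hv := (FinGraph.vol_nonneg (x.m_nonneg (x.graph.coreLevel x.m)) x.graph.core).lt_of_ne'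
    x.vol_coreLevel_ne_zero
  by_contra hne
  have hpos := (x.m_nonneg (x.graph.coreLevel x.m) d).lt_of_ne' hne
  have : 0 < x.graph.flow x.m t 0 d := by
    simp only [FinGraph.flow, indicator_of_mem hd]
    have h1 := mul_nonneg (sub_nonneg.2 ht1) (x.m_nonneg 0 d)
    have h2 := mul_pos ht (div_pos hpos hv)
    linarith
  exact this.ne' h

/-- For t > 0 an edge of the core has zero length in all new metrics only if it did in all old ones,
so only separating edges can be collapsed, and these form a forest. The new i-th subgraph, for i ≥
1, agrees with Γ_{i+l} up to collapsed edges. -/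
theorem exists_flow (t : ℝ) (ht : 0 ≤ t) (ht1 : t ≤ 1) :
    ∃ z : ClosedCell x.graph, z.metric = x.graph.flow x.m t ∧
      z.1.depth = x.depth - x.graph.shift x.m t := by
  rcases ht.eq_or_lt with rfl | ht
  · exact ⟨.self x, by rw [ClosedCell.metric_self, FinGraph.flow_at_zero], by
      simp [FinGraph.shift, ClosedCell.self]⟩
  have hs : x.graph.shift x.m t = x.graph.coreLevel x.m := if_neg ht.ne'
  have hl := x.coreLevel_le_depth
  set l := x.graph.coreLevel x.m with hl_def
  have hsucc : ∀ i, x.graph.flow x.m t (i + 1) = x.m (i + 1 + l) := fun i => by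
    rw [FinGraph.flow, hs]
  have hz : ∀ d, x.m 0 d = 0 → x.m l d = 0 → x.graph.flow x.m t 0 d = 0 := fun d h0 h1 => by
    simp [FinGraph.flow, ← hl_def, h0, h1]
  have hcore : ∀ d ∈ x.graph.core, (∀ j, x.graph.flow x.m t j d = 0) → False := by
    intro d hd h
    obtain ⟨i, hi, -⟩ := x.nondegenerate d
    rcases lt_trichotomy i l with hil | rfl | hil
    · exact hi (x.eq_zero_of_lt_coreLevel hil hd)
    · exact hi (x.flow_zero_eq_zero ht ht1 (h 0) hd)
    · obtain ⟨j, rfl⟩ := Nat.exists_eq_add_of_lt hil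
      have := h (j + 1)
      rw [hsucc, show j + 1 + l = l + j + 1 by omega] at this
      exact hi this
  suffices h : ∃ z : ClosedCell x.graph, z.1.depth = x.depth - l ∧
      z.metric = x.graph.flow x.m t by
    obtain ⟨z, h1, h2⟩ := h
    exact ⟨z, h2, by rw [h1, hs]⟩
  refine ClosedCell.exists_of_metric _ _ _ ?_ ?_ ?_ ?_ ?_ ?_ ?_
  · rintro (_ | i) d
    · simp only [FinGraph.flow]
      refine add_nonneg (mul_nonneg (sub_nonneg.2 ht1) (x.m_nonneg 0 d)) (mul_nonneg ht.le ?_)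
      exact div_nonneg (indicator_nonneg (fun d _ => x.m_nonneg _ d) _)
        (FinGraph.vol_nonneg (x.m_nonneg _) _)
    · exact x.m_nonneg _ d
  · rintro (_ | i) d
    · classical
      simp only [FinGraph.flow, indicator_apply, x.m_inv,
        FinGraph.isSubgraph_core.inv_mem_iff]
    · exact x.m_inv _ d
  · have key : ∀ d j, x.graph.flow x.m t 0 d ≠ 0 → x.graph.flow x.m t (j + 1) d ≠ 0 → False := by
      intro d j h0 hj
      rw [hsucc] at hj
      exact h0 (hz d (x.eq_zero_of_ne hj (by omega)) (x.eq_zero_of_ne hj (by omega)))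
    rintro d (_ | i) (_ | j) hi hj
    · rfl
    · exact (key d j hi hj).elim
    · exact (key d i hj hi).elim
    · rw [hsucc] at hi hj
      have := (x.nondegenerate d).unique hi hj
      omega
  · rintro (_ | i) d hi
    · exact Nat.zero_le _
    · rw [hsucc] at hi
      have := x.le_depth _ d hi
      omega
  · rintro (_ | i) hi
    · rw [FinGraph.vol_flow_zero _ _ x.vol_coreLevel_ne_zero, x.vol_eq_one 0 (Nat.zero_le _)]
      ring
    · rw [hsucc]
      exact x.vol_eq_one _ (by omega)
  · exact FinGraph.isForest_compl_core.mono fun d hd hdc => hcore d hdc hd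
  · intro i hi hik d hd hne
    have hsub : {d | ∀ j < i + l, x.m j d = 0} ⊆ {d | ∀ j < i, x.graph.flow x.m t j d = 0} := by
      rintro a ha (_ | j) hj
      · exact hz a (ha 0 (by omega)) (ha l (by omega))
      · rw [hsucc]
        exact ha _ (by omega)
    -- A surviving edge of the new i-th subgraph is not separating: a separating edge is nonzero in
    -- m_0 only, so it could survive only in the new metric of index 0, which vanishes on this
    -- subgraph. Hence the edge lies in the core and in Γ_{i+l}.
    have hda : ∀ j < i + l, x.m j d = 0 := by
      by_cases hdc : d ∈ x.graph.core
      · intro j hj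
        rcases lt_trichotomy j l with hjl | rfl | hjl
        · exact x.eq_zero_of_lt_coreLevel hjl hdc
        · exact x.flow_zero_eq_zero ht ht1 (hd 0 (by omega)) hdc
        · obtain ⟨k, rfl⟩ := Nat.exists_eq_add_of_lt hjl
          have := hd (k + 1) (by omega)
          rwa [hsucc, show k + 1 + l = l + k + 1 by omega] at this
      · exfalso
        obtain ⟨j, hj⟩ := hne
        cases j with
        | zero => exact hj (hd 0 (by omega))
        | succ j =>
          rw [hsucc] at hj
          exact hj (x.eq_zero_of_ne (x.m_zero_ne_zero hdc) (by omega))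
    intro hsep
    exact (x.isCore (i + l) (by omega) (by omega)).not_separating d hda (hsep.mono hsub)

/-- The flow on representatives of points. -/
def flow (t : unitInterval) : ClosedCell x.graph := (x.exists_flow t t.2.1 t.2.2).choose

theorem metric_flow (t : unitInterval) : (x.flow t).metric = x.graph.flow x.m t :=
  (x.exists_flow t t.2.1 t.2.2).choose_spec.1

theorem depth_flow (t : unitInterval) : (x.flow t).1.depth = x.depth - x.graph.shift x.m t :=
  (x.exists_flow t t.2.1 t.2.2).choose_spec.2

end Point

/-! ### Naturality and continuity of the flow on closed cells -/

namespace ClosedCell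

variable {n : ℕ} {G H : MarkedGraph n}

theorem vol_metric_pullback (c : G.Collapse H) (z : ClosedCell H) (i : ℕ) :
    G.vol ((pullback c z).metric i) G.core = H.vol (z.metric i) H.core := by
  rw [metric_pullback, ← c.contraction.preimage_core]
  exact c.contraction.vol_extend _ _

theorem coreLevel_pullback (c : G.Collapse H) (z : ClosedCell H) :
    G.coreLevel (pullback c z).metric = H.coreLevel z.metric := by
  simp only [FinGraph.coreLevel, vol_metric_pullback]

/-- Collapsing a forest preserves whether a surviving edge separates, so core, core level and core
volume can be computed in either graph. -/
theorem flow_pullback (c : G.Collapse H) (z : ClosedCell H) (t : ℝ) (i : ℕ) :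
    G.flow (pullback c z).metric t i = Function.extend c.edge (H.flow z.metric t i) 0 := by
  cases i with
  | zero =>
    funext d
    classical
    simp only [FinGraph.flow, coreLevel_pullback, vol_metric_pullback]
    simp only [metric_pullback]
    by_cases hd : d ∈ range c.edge
    · obtain ⟨e, rfl⟩ := hd
      have : e ∈ H.core ↔ c.edge e ∈ G.core := by
        rw [← c.contraction.preimage_core]
        rfl
      simp only [c.edge_injective.extend_apply, indicator_apply, this]
    · have hd : ¬ ∃ e, c.edge e = d := hd
      simp [Function.extend_apply' _ _ _ hd]
  | succ i =>
    simp only [FinGraph.flow, FinGraph.shift, coreLevel_pullback, metric_pullback]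

theorem metric_pullback_self (z : ClosedCell G) : (pullback z.2 (self z.1)).metric = z.metric := by
  funext i
  rw [metric_pullback, metric_self]
  rfl

theorem vol_coreLevel_ne_zero (z : ClosedCell G) :
    G.vol (z.metric (G.coreLevel z.metric)) G.core ≠ 0 := by
  rw [← metric_pullback_self, coreLevel_pullback, vol_metric_pullback, metric_self]
  exact z.1.vol_coreLevel_ne_zero

theorem eq_zero_of_lt_coreLevel (z : ClosedCell G) {j : ℕ} (hj : j < G.coreLevel z.metric)
    {d : G.D} (hd : d ∈ G.core) : z.metric j d = 0 :=
  (FinGraph.vol_eq_zero_iff (z.metric_nonneg j)).1 (not_not.1 (Nat.notMem_of_lt_sInf hj)) d hd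

/-- The flow on a closed cell. -/
def flow (z : ClosedCell G) (t : unitInterval) : ClosedCell G := pullback z.2 (z.1.flow t)

theorem metric_flow (z : ClosedCell G) (t : unitInterval) :
    (z.flow t).metric = G.flow z.metric t := by
  funext i
  rw [flow, metric_pullback, Point.metric_flow, ← metric_pullback_self z, flow_pullback,
    metric_self]

/-- On the core the metrics below the core level vanish and, for t > 0, the flow shifts the
remaining ones, rescaling only the first. Normalization on `C` removes the scale and the level
absorbs the shift. -/
theorem coord_flow_of_subset (z : ClosedCell G) (t : unitInterval)
    (C : {C : Set G.D // G.IsCore C ∨ C = univ}) (hC : C.1 ⊆ G.core) (d : C.1) :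
    (z.flow t).coord C d = z.coord C d := by
  rcases t.2.1.eq_or_lt with ht | ht
  · unfold coord level
    rw [metric_flow, ← ht, FinGraph.flow_at_zero]
  have hv := (FinGraph.vol_nonneg (z.metric_nonneg (G.coreLevel z.metric)) G.core).lt_of_ne'
    z.vol_coreLevel_ne_zero
  -- The contribution 1 - t of m_0 is a multiple of the metric at the core level only if that level
  -- is 0; otherwise m_0 vanishes on the core.
  let a : ℕ → ℝ
    | 0 => (if G.coreLevel z.metric = 0 then 1 - (t : ℝ) else 0) +
      t / G.vol (z.metric (G.coreLevel z.metric)) G.core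
    | i + 1 => 1
  refine FinGraph.normalized_eq z.metric (z.flow t).metric (G.coreLevel z.metric) a ?_ ?_
    (fun j hj d hd => z.eq_zero_of_lt_coreLevel hj (hC hd)) d.2
  · rintro (_ | i)
    · have h1 := div_pos ht hv
      have h2 : (0 : ℝ) ≤ if G.coreLevel z.metric = 0 then 1 - (t : ℝ) else 0 := by
        split_ifs
        exacts [sub_nonneg.2 t.2.2, le_rfl]
      exact (add_pos_of_nonneg_of_pos h2 h1).ne'
    · exact one_ne_zero
  · rintro (_ | i) d hd
    · rw [metric_flow]
      simp only [FinGraph.flow, indicator_of_mem (hC hd), a, zero_add]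
      split_ifs with h
      · rw [h]
        ring
      · rw [z.eq_zero_of_lt_coreLevel (Nat.pos_of_ne_zero h) (hC hd)]
        ring
    · rw [metric_flow]
      simp [FinGraph.flow, FinGraph.shift, a, ht.ne']

theorem level_univ (z : ClosedCell G) : z.level univ = 0 := by
  refine Nat.sInf_eq_zero.2 (Or.inl ?_)
  exact (z.le_depth_iff 0).1 (Nat.zero_le _)

theorem coord_univ (z : ClosedCell G) (d : (univ : Set G.D)) :
    z.coord ⟨univ, Or.inr rfl⟩ d = z.metric 0 d := by
  simp only [coord, level_univ, z.vol_metric_univ (Nat.zero_le _), div_one]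

open Classical in
theorem coord_flow_univ (z : ClosedCell G) (t : unitInterval) (d : (univ : Set G.D)) :
    (z.flow t).coord ⟨univ, Or.inr rfl⟩ d = (1 - t) * z.coord ⟨univ, Or.inr rfl⟩ d +
      t * (if hd : d.1 ∈ G.core then z.coord ⟨G.core, Or.inl FinGraph.isCore_core⟩ ⟨d, hd⟩
        else 0) := by
  rw [coord_univ, coord_univ, metric_flow]
  simp only [FinGraph.flow]
  by_cases hd : d.1 ∈ G.core
  · rw [indicator_of_mem hd, dif_pos hd]
    rfl
  · rw [indicator_of_notMem hd, dif_neg hd, zero_div]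

theorem continuous_coord (C : {C : Set G.D // G.IsCore C ∨ C = univ}) (d : C.1) :
    Continuous fun z : ClosedCell G => z.coord C d := by
  have h : Continuous (coord : ClosedCell G → _) := continuous_induced_dom
  exact (continuous_apply d).comp ((continuous_apply C).comp h)

theorem continuous_flow : Continuous fun zt : ClosedCell G × unitInterval => zt.1.flow zt.2 := by
  classical
  refine continuous_induced_rng.2 (continuous_pi fun C => continuous_pi fun d => ?_)
  obtain ⟨C, hC⟩ := C
  rcases id hC with hC' | rfl
  · have : (fun zt : ClosedCell G × unitInterval => (zt.1.flow zt.2).coord ⟨C, hC⟩ d) =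
        fun zt => zt.1.coord ⟨C, hC⟩ d :=
      funext fun zt => coord_flow_of_subset _ _ _ hC'.subset_core _
    exact this ▸ (continuous_coord _ d).comp continuous_fst
  · have : (fun zt : ClosedCell G × unitInterval => (zt.1.flow zt.2).coord ⟨univ, hC⟩ d) = _ :=
      funext fun zt => coord_flow_univ zt.1 zt.2 d
    change Continuous fun zt : ClosedCell G × unitInterval => (zt.1.flow zt.2).coord ⟨univ, hC⟩ d
    rw [this]
    refine Continuous.add (Continuous.mul (by fun_prop) ((continuous_coord _ _).comp continuous_fst))
      (Continuous.mul (by fun_prop) ?_)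
    by_cases hd : d.1 ∈ G.core
    · simp only [dif_pos hd]
      exact (continuous_coord _ _).comp continuous_fst
    · simp only [dif_neg hd]
      exact continuous_const

end ClosedCell

/-! ### The flow on the bordification -/

namespace XHat

variable {n : ℕ}

theorem mk_eq_iff {x y : Point n} : mk x = mk y ↔ x.Equivalent y := Quotient.eq

theorem mk_eq_of_metric_eq {G : MarkedGraph n} {z z' : ClosedCell G} (h : z.metric = z'.metric) :
    mk z.1 = mk z'.1 :=
  mk_eq_iff.2 (z.equivalent_of_metric_eq z' h)

/-- An isomorphism is a collapse of the empty forest, so both flows can be compared inside the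
closed cell of `x.graph`. -/
theorem mk_flow_eq_of_equivalent {x y : Point n} (h : x.Equivalent y) (t : unitInterval) :
    mk (x.flow t).1 = mk (y.flow t).1 := by
  obtain ⟨i, -, hm⟩ := h
  let c := MarkedGraph.Collapse.ofIso i
  refine mk_eq_of_metric_eq (z' := .pullback c (y.flow t)) ?_
  have hx : (ClosedCell.pullback c (.self y)).metric = x.m := by
    funext j d
    have hd : c.edge (i.onD d) = d := i.onD.symm_apply_apply d
    rw [← hd, ClosedCell.metric_pullback_edge, ClosedCell.metric_self, hm, hd]
  funext j
  rw [ClosedCell.metric_pullback, Point.metric_flow, Point.metric_flow, ← hx,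
    ClosedCell.flow_pullback, ClosedCell.metric_self]

/-- The flow on the bordification. -/
def flow (zt : XHat n × unitInterval) : XHat n :=
  Quotient.lift (fun x : Point n => mk (x.flow zt.2).1)
    (fun _ _ h => mk_flow_eq_of_equivalent h zt.2) zt.1

theorem flow_mk {G : MarkedGraph n} (z z' : ClosedCell G) (t : unitInterval)
    (h : z'.metric = G.flow z.metric t) : flow (mk z.1, t) = mk z'.1 :=
  mk_eq_of_metric_eq (z := z.flow t) ((z.metric_flow t).trans h.symm)

theorem continuous_mk (G : MarkedGraph n) : Continuous fun z : ClosedCell G => mk z.1 :=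
  continuous_iSup_rng (i := G) continuous_coinduced_rng

theorem continuous_dom_iff {T : Type*} [TopologicalSpace T] {f : XHat n → T} :
    Continuous f ↔ ∀ G : MarkedGraph n, Continuous fun z : ClosedCell G => f (mk z.1) := by
  rw [continuous_iSup_dom]
  exact forall_congr' fun G => continuous_coinduced_dom

theorem continuous_flow : Continuous (flow (n := n)) := by
  have h : ∀ G : MarkedGraph n, Continuous fun zt : ClosedCell G × unitInterval =>
      flow (mk zt.1.1, zt.2) := fun G => (continuous_mk G).comp ClosedCell.continuous_flow
  have hz : ∀ z : XHat n, Continuous fun t => flow (z, t) := by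
    rintro ⟨x⟩
    exact (h x.graph).comp (Continuous.prodMk_right (ClosedCell.self x))
  -- The topology of the product is not given directly by closed cells. Currying reduces to a map
  -- out of the bordification, which can be tested cell by cell; uncurrying uses local compactness
  -- of the interval.
  let F : XHat n → C(unitInterval, XHat n) := fun z => ⟨fun t => flow (z, t), hz z⟩
  have hF : Continuous F := continuous_dom_iff.2 fun G =>
    ContinuousMap.continuous_of_continuous_uncurry _ (h G)
  exact ContinuousMap.continuous_uncurry_of_continuous ⟨F, hF⟩

end XHat

/-! ### The closure of the set of graphs without separating edges -/

theorem FinGraph.Contraction.hasSeparatingEdge {G H : FinGraph} (c : FinGraph.Contraction G H)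
    (h : H.HasSeparatingEdge) : G.HasSeparatingEdge := by
  obtain ⟨e, he⟩ := h
  exact ⟨c.edge e, (c.isSeparatingIn_iff (A := univ) (subset_univ _)).1 he⟩

namespace ClosedCell

variable {n : ℕ} {G : MarkedGraph n}

/-- A surviving separating edge of `G` is still separating and has positive m_0-length; so having
none is a closed condition on the coordinates of the whole graph. -/
theorem not_hasSeparatingEdge_iff (z : ClosedCell G) :
    ¬ z.1.graph.HasSeparatingEdge ↔ ∀ d ∉ G.core, z.metric 0 d = 0 := by
  have hc := z.2.contraction.preimage_core
  rw [← FinGraph.core_eq_univ_iff]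
  constructor
  · intro h d hd
    by_cases hr : d ∈ range z.2.edge
    · obtain ⟨e, rfl⟩ := hr
      have : e ∈ z.2.contraction.edge ⁻¹' G.core := by
        rw [hc, h]
        trivial
      exact (hd this).elim
    · exact z.metric_collapsed 0 hr
  · intro h
    rw [eq_univ_iff_forall]
    intro e
    by_contra he
    have h0 := z.1.m_zero_ne_zero he
    rw [← metric_edge] at h0
    refine h0 (h _ fun hd => he ?_)
    rw [← hc]
    exact hd

end ClosedCell

namespace XHat

variable {n : ℕ}

/-- The points whose underlying graph has no separating edges. -/
def noSeparatingEdge (n : ℕ) : Set (XHat n) :=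
  {z | ∃ x : Point n, mk x = z ∧ ¬ x.graph.HasSeparatingEdge}

theorem mk_mem_noSeparatingEdge {x : Point n} :
    mk x ∈ noSeparatingEdge n ↔ ¬ x.graph.HasSeparatingEdge := by
  refine ⟨?_, fun h => ⟨x, rfl, h⟩⟩
  rintro ⟨y, hy, h⟩ hx
  obtain ⟨i, -⟩ := mk_eq_iff.1 hy
  exact h ((MarkedGraph.Collapse.ofIso i).contraction.hasSeparatingEdge hx)

theorem mk_mem_X {x : Point n} : mk x ∈ X n ↔ x.depth = 0 := by
  refine ⟨?_, fun h => ⟨x, rfl, h⟩⟩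
  rintro ⟨y, hy, h⟩
  obtain ⟨-, h', -⟩ := mk_eq_iff.1 hy
  rw [← h', h]

theorem isClosed_noSeparatingEdge : IsClosed (noSeparatingEdge n) := by
  rw [← isOpen_compl_iff, isOpen_iSup_iff]
  intro G
  rw [isOpen_coinduced, preimage_compl, isOpen_compl_iff]
  have : (fun z : ClosedCell G => mk z.1) ⁻¹' noSeparatingEdge n =
      ⋂ d : {d // d ∉ G.core}, {z | z.coord ⟨univ, Or.inr rfl⟩ ⟨d.1, trivial⟩ = 0} := by
    ext z
    simp only [mem_preimage, mk_mem_noSeparatingEdge, z.not_hasSeparatingEdge_iff, mem_iInter,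
      mem_ofPred_eq, ClosedCell.coord_univ, Subtype.forall]
  rw [this]
  exact isClosed_iInter fun d =>
    isClosed_singleton.preimage (ClosedCell.continuous_coord (G := G) _ _)

theorem Y_subset_noSeparatingEdge : Y n ⊆ noSeparatingEdge n := by
  rintro _ ⟨x, rfl, -, h⟩
  exact ⟨x, rfl, h⟩

end XHat

/-- The quotient of two polynomials tends to the quotient of the lowest coefficients. -/
theorem tendsto_sum_div_sum (a b : ℕ → ℝ) (k l : ℕ) (hl : l ≤ k) (ha : ∀ i < l, a i = 0)
    (hb : ∀ i < l, b i = 0) (hbl : b l ≠ 0) :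
    Filter.Tendsto (fun ε : ℝ => (∑ i ∈ Finset.range (k + 1), ε ^ i * a i) /
      ∑ i ∈ Finset.range (k + 1), ε ^ i * b i) (𝓝[>] 0) (𝓝 (a l / b l)) := by
  have key : ∀ c : ℕ → ℝ, (∀ i < l, c i = 0) →
      (∀ ε : ℝ, ∑ i ∈ Finset.range (k + 1), ε ^ i * c i =
        ε ^ l * ∑ i ∈ Finset.range (k + 1), ε ^ (i - l) * c i) ∧
      Filter.Tendsto (fun ε : ℝ => ∑ i ∈ Finset.range (k + 1), ε ^ (i - l) * c i) (𝓝[>] 0)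
        (𝓝 (c l)) := by
    intro c hc
    constructor
    · intro ε
      rw [Finset.mul_sum]
      refine Finset.sum_congr rfl fun i _ => ?_
      rcases lt_or_ge i l with hi | hi
      · simp [hc i hi]
      · rw [← mul_assoc, ← pow_add, Nat.add_sub_cancel' hi]
    · have hcont : Continuous fun ε : ℝ => ∑ i ∈ Finset.range (k + 1), ε ^ (i - l) * c i := by
        fun_prop
      have h0 : ∑ i ∈ Finset.range (k + 1), (0 : ℝ) ^ (i - l) * c i = c l := by
        rw [Finset.sum_eq_single l]
        · simp
        · intro i _ hi
          rcases lt_or_gt_of_ne hi with hi | hi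
          · simp [hc i hi]
          · rw [zero_pow (by omega), zero_mul]
        · intro h
          exact (h (Finset.mem_range.2 (by omega))).elim
      have := (hcont.tendsto 0).mono_left (nhdsWithin_le_nhds (s := Ioi 0))
      rwa [h0] at this
  obtain ⟨ha1, ha2⟩ := key a ha
  obtain ⟨hb1, hb2⟩ := key b hb
  refine (ha2.div hb2 hbl).congr' ?_
  filter_upwards [self_mem_nhdsWithin] with ε hε
  rw [Pi.div_apply, ha1, hb1, mul_div_mul_left _ _ (pow_pos (mem_Ioi.1 hε) l).ne']

theorem FinGraph.vol_sum {G : FinGraph} {ι : Type*} (s : Finset ι) (a : ι → ℝ)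
    (m : ι → G.D → ℝ) (A : Set G.D) :
    G.vol (fun d => ∑ i ∈ s, a i * m i d) A = ∑ i ∈ s, a i * G.vol (m i) A := by
  classical
  induction s using Finset.induction_on with
  | empty => simp [vol]
  | insert i s hi ih =>
    simp only [Finset.sum_insert hi, ← ih]
    have := vol_smul_add (a i) 1 (m i) (fun d => ∑ i ∈ s, a i * m i d) A
    simpa using this

/-! ### Approximation by points of Outer space -/

namespace Point

variable {n : ℕ} (x : Point n)

/-- The weighted sum of all the metrics of a point. -/
def combined (ε : ℝ) (d : x.graph.D) : ℝ := ∑ i ∈ Finset.range (x.depth + 1), ε ^ i * x.m i d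

theorem combined_pos {ε : ℝ} (hε : 0 < ε) (d : x.graph.D) : 0 < x.combined ε d := by
  obtain ⟨i, hi, -⟩ := x.nondegenerate d
  refine Finset.sum_pos' (fun j _ => mul_nonneg (pow_pos hε j).le (x.m_nonneg j d)) ⟨i, ?_, ?_⟩
  · exact Finset.mem_range.2 (Nat.lt_succ_of_le (x.le_depth i d hi))
  · exact mul_pos (pow_pos hε i) ((x.m_nonneg i d).lt_of_ne' hi)

theorem vol_combined (ε : ℝ) (A : Set x.graph.D) : x.graph.vol (x.combined ε) A =
    ∑ i ∈ Finset.range (x.depth + 1), ε ^ i * x.graph.vol (x.m i) A :=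
  FinGraph.vol_sum _ _ _ _

theorem vol_combined_pos {ε : ℝ} (hε : 0 < ε) {A : Set x.graph.D} {d : x.graph.D} (hd : d ∈ A) :
    0 < x.graph.vol (x.combined ε) A := by
  refine (FinGraph.vol_nonneg (fun d => (x.combined_pos hε d).le) A).lt_of_ne' fun h => ?_
  exact (x.combined_pos hε d).ne'
    ((FinGraph.vol_eq_zero_iff fun d => (x.combined_pos hε d).le).1 h d hd)

/-- The point of Outer space given by a weighted sum of all the metrics. -/
def smoothing {ε : ℝ} (hε : 0 < ε) : Point n where
  graph := x.graph
  depth := 0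
  m i d := if i = 0 then x.combined ε d / x.graph.vol (x.combined ε) univ else 0
  m_nonneg i d := by
    split_ifs
    · exact div_nonneg (x.combined_pos hε d).le
        (FinGraph.vol_nonneg (fun d => (x.combined_pos hε d).le) _)
    · exact le_rfl
  m_inv i d := by simp only [combined, x.m_inv]
  nondegenerate d := by
    refine ⟨0, ?_, fun i hi => ?_⟩
    · simp only [if_true]
      exact (div_pos (x.combined_pos hε d) (x.vol_combined_pos hε (mem_univ d))).ne'
    · by_contra h
      exact hi (if_neg h)
  le_depth i d hi := by
    by_contra h
    exact hi (if_neg (by omega))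
  vol_eq_one i hi := by
    obtain ⟨d, -⟩ := x.graph.core_nonempty
    have hv := x.vol_combined_pos hε (mem_univ d)
    have := FinGraph.vol_const_mul (x.graph.vol (x.combined ε) univ)⁻¹ (x.combined ε) univ
    rw [inv_mul_cancel₀ hv.ne'] at this
    rw [← this]
    simp [Nat.le_zero.1 hi, div_eq_inv_mul]
  isCore i h1 h2 := by omega

/-- The smoothing of a point in the closed cell of its graph. -/
def smoothingCell {ε : ℝ} (hε : 0 < ε) : ClosedCell x.graph := .self (x.smoothing hε)

theorem metric_smoothingCell {ε : ℝ} (hε : 0 < ε) :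
    (x.smoothingCell hε).metric = (x.smoothing hε).m :=
  ClosedCell.metric_self (x.smoothing hε)

theorem coord_smoothingCell {ε : ℝ} (hε : 0 < ε)
    (C : {C : Set x.graph.D // x.graph.IsCore C ∨ C = univ}) (d : C.1) :
    (x.smoothingCell hε).coord C d =
      x.combined ε d / x.graph.vol (x.combined ε) C := by
  have hC := x.vol_combined_pos hε d.2
  have hv := x.vol_combined_pos hε (mem_univ d.1)
  have hm : (x.smoothingCell hε).metric 0 =
      fun d => (x.graph.vol (x.combined ε) univ)⁻¹ * x.combined ε d := by
    rw [metric_smoothingCell]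
    funext d
    simp [smoothing, div_eq_inv_mul]
  have hvol : x.graph.vol ((x.smoothingCell hε).metric 0) C.1 =
      (x.graph.vol (x.combined ε) univ)⁻¹ * x.graph.vol (x.combined ε) C := by
    rw [hm]
    exact FinGraph.vol_const_mul _ _ _
  have hlevel : (x.smoothingCell hε).level C.1 = 0 := by
    refine Nat.sInf_eq_zero.2 (Or.inl ?_)
    change x.graph.vol ((x.smoothingCell hε).metric 0) C.1 ≠ 0
    rw [hvol]
    exact (mul_pos (inv_pos.2 hv) hC).ne'
  unfold ClosedCell.coord
  rw [hlevel]
  refine Eq.trans (congrArg₂ (· / ·) (congrFun hm d.1) hvol) ?_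
  exact mul_div_mul_left _ _ (inv_pos.2 hv).ne'

/-- Each coordinate is a quotient of polynomials in ε. The lowest index at which the volume of `C`
is nonzero is the level of `C`, so the limit is the coordinate of the original point. -/
theorem tendsto_smoothingCell : Filter.Tendsto
    (fun j : ℕ => x.smoothingCell (Nat.one_div_pos_of_nat (α := ℝ) (n := j))) Filter.atTop (𝓝 (ClosedCell.self x)) := by
  have hind : IsInducing (ClosedCell.coord : ClosedCell x.graph → _) := ⟨rfl⟩
  rw [hind.tendsto_nhds_iff, tendsto_pi_nhds]
  refine fun C => tendsto_pi_nhds.2 fun d => ?_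
  have hε : Filter.Tendsto (fun j : ℕ => 1 / ((j : ℝ) + 1)) Filter.atTop (𝓝[>] 0) :=
    tendsto_nhdsWithin_iff.2 ⟨tendsto_one_div_add_atTop_nhds_zero_nat,
      Filter.Eventually.of_forall fun _ => mem_Ioi.2 Nat.one_div_pos_of_nat⟩
  let l := (ClosedCell.self x).level C.1
  have hne : {i | x.graph.vol (x.m i) C.1 ≠ 0}.Nonempty := by
    obtain ⟨i, hi, -⟩ := x.nondegenerate d.1
    exact ⟨i, fun h => hi ((FinGraph.vol_eq_zero_iff (x.m_nonneg i)).1 h _ d.2)⟩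
  have hl : l = sInf {i | x.graph.vol (x.m i) C.1 ≠ 0} := by
    simp only [l, ClosedCell.level, ClosedCell.metric_self]
  have hv : x.graph.vol (x.m l) C.1 ≠ 0 := by
    rw [hl]
    exact Nat.sInf_mem hne
  have hz : ∀ i < l, x.graph.vol (x.m i) C.1 = 0 := fun i hi => by
    rw [hl] at hi
    exact not_not.1 (Nat.notMem_of_lt_sInf hi)
  have hlk : l ≤ x.depth := by
    have hv' := hv
    rw [Ne, FinGraph.vol_eq_zero_iff (x.m_nonneg _)] at hv'
    push Not at hv'
    obtain ⟨e, -, he⟩ := hv'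
    exact x.le_depth _ e he
  have key := (tendsto_sum_div_sum (fun i => x.m i d.1) (fun i => x.graph.vol (x.m i) C.1) x.depth l
    hlk (fun i hi => (FinGraph.vol_eq_zero_iff (x.m_nonneg i)).1 (hz i hi) _ d.2) hz hv).comp hε
  have hlim : (ClosedCell.self x).coord C d = x.m l d.1 / x.graph.vol (x.m l) C.1 := by
    unfold ClosedCell.coord
    rw [ClosedCell.metric_self]
  change Filter.Tendsto (fun j : ℕ => (x.smoothingCell
    (Nat.one_div_pos_of_nat (α := ℝ) (n := j))).coord C d) _ (𝓝 ((ClosedCell.self x).coord C d))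
  rw [hlim]
  refine key.congr fun j => ?_
  rw [x.coord_smoothingCell, vol_combined]
  rfl

end Point

namespace XHat

variable {n : ℕ}

theorem YHat_eq : YHat n = noSeparatingEdge n := by
  refine Subset.antisymm (closure_minimal Y_subset_noSeparatingEdge isClosed_noSeparatingEdge) ?_
  rintro _ ⟨x, rfl, h⟩
  refine mem_closure_of_tendsto (((continuous_mk x.graph).tendsto _).comp x.tendsto_smoothingCell) ?_
  exact Filter.Eventually.of_forall fun j => ⟨_, rfl, rfl, h⟩

theorem flow_eq_self {x : Point n} (h : ¬ x.graph.HasSeparatingEdge) (t : unitInterval) :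
    flow (mk x, t) = mk x := by
  refine flow_mk (.self x) (.self x) t ?_
  rw [ClosedCell.metric_self]
  have hc := FinGraph.core_eq_univ_iff.2 h
  have hv := x.vol_eq_one 0 (Nat.zero_le _)
  have hl : x.graph.coreLevel x.m = 0 := by
    refine Nat.sInf_eq_zero.2 (Or.inl ?_)
    change x.graph.vol (x.m 0) x.graph.core ≠ 0
    rw [hc, hv]
    exact one_ne_zero
  funext i d
  cases i with
  | zero =>
    simp only [FinGraph.flow, hl, hc, hv, indicator_univ]
    ring
  | succ i =>
    simp [FinGraph.flow, FinGraph.shift, hl]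

theorem isEquivariantDeformationRetraction_flow (n : ℕ) :
    IsEquivariantDeformationRetraction (Out n) (YHat n) (flow (n := n)) where
  continuous := continuous_flow
  map_zero := by
    rintro ⟨x⟩
    refine flow_mk (.self x) (.self x) 0 ?_
    rw [show ((0 : unitInterval) : ℝ) = 0 from rfl, FinGraph.flow_at_zero]
  map_one := by
    rintro ⟨x⟩
    rw [YHat_eq]
    refine mk_mem_noSeparatingEdge.2 ((x.flow 1).not_hasSeparatingEdge_iff.2 fun d hd => ?_)
    rw [Point.metric_flow]
    simp [FinGraph.flow, hd]
  fixes := by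
    rintro z hz t
    rw [YHat_eq] at hz
    obtain ⟨x, rfl, h⟩ := hz
    exact flow_eq_self h t
  equivariant := by
    rintro g ⟨x⟩ t
    obtain ⟨a, rfl⟩ := QuotientGroup.mk_surjective g
    -- Twisting changes only the marking, so the twisted flow has the required metrics.
    refine flow_mk (.self (x.twist a)) ⟨(x.flow t).1.twist a, (x.flow t).2.twist a⟩ t ?_
    rw [ClosedCell.metric_self]
    exact x.metric_flow t

end XHat

/-! ### Cut vertices and separating edges -/

namespace FinGraph

theorem JoinedIn.mem_of_closed {G : FinGraph} {A : Set G.D} {u v : G.V} (h : G.JoinedIn A u v)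
    {S : Set G.V} (hS : ∀ d ∈ A, G.src d ∈ S → G.tgt d ∈ S) (hu : u ∈ S) : v ∈ S := by
  obtain ⟨p, hp, hpA⟩ := h
  induction p generalizing u with
  | nil => exact (show u = v from hp) ▸ hu
  | cons d p ih =>
    obtain ⟨rfl, hp⟩ := hp
    exact ih (hS d (hpA d (by simp)) hu) hp fun a ha => hpA a (by simp [ha])

/-- Collapsing a forest that contains a separating edge creates a cut vertex. -/
theorem Contraction.hasCutVertex {G H : FinGraph} (c : Contraction G H)
    (hG : ∀ v, 3 ≤ G.valence v) {d₀ : G.D} (hd₀ : d₀ ∈ c.collapsed)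
    (hs : G.IsSeparatingIn univ d₀) : H.HasCutVertex := by
  have hsub := (isSubgraph_univ (G := G)).diff_edge d₀
  -- `U` is one side of the separating edge. A collapsed path leaving `U` has to cross that edge, so
  -- the two sides meet in `H` only at the image of its endpoints.
  let U : Set G.V := {u | G.JoinedIn (univ \ {d₀, G.inv d₀}) u (G.src d₀)}
  have htgt : G.tgt d₀ ∉ U := fun h => hs (h.symm hsub)
  have hU : ∀ d, d ∉ ({d₀, G.inv d₀} : Set G.D) → G.src d ∈ U → G.tgt d ∈ U := fun d hd h =>
    ((joinedIn_dart (show d ∈ univ \ {d₀, G.inv d₀} from ⟨trivial, hd⟩)).symm hsub).trans h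
  have hne : ∀ e, c.edge e ∉ ({d₀, G.inv d₀} : Set G.D) := by
    rintro e (h | h)
    · exact c.edge_not_mem e (h ▸ hd₀)
    · exact c.edge_not_mem e (h ▸ c.isSubgraph_collapsed _ hd₀)
  have hcross : ∀ u w, G.JoinedIn c.collapsed u w → u ∈ U → w ∉ U →
      c.onV u = c.onV (G.src d₀) := by
    rintro u w ⟨p, hp, hpA⟩ hu hw
    induction p generalizing u with
    | nil => exact (hw ((show u = w from hp) ▸ hu)).elim
    | cons d p ih =>
      obtain ⟨rfl, hp⟩ := hp
      have hd := hpA d (by simp)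
      by_cases ht : G.tgt d ∈ U
      · rw [c.onV_src_eq_tgt hd]
        exact ih _ hp (fun a ha => hpA a (by simp [ha])) ht
      · have hd' : d ∈ ({d₀, G.inv d₀} : Set G.D) := by
          by_contra h
          exact ht (hU d h hu)
        rcases hd' with rfl | rfl
        · rfl
        · rw [src_inv] at hu
          exact (htgt hu).elim
  have hdart : ∀ v, 2 ≤ {a | G.src a = v ∧ a ∉ c.collapsed}.ncard →
      ∃ e, G.src (c.edge e) = v := fun v hv => by
    obtain ⟨a, ha⟩ := nonempty_of_ncard_ne_zero
      (s := {a | G.src a = v ∧ a ∉ c.collapsed}) (by omega)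
    obtain ⟨e, rfl⟩ := c.eq_edge_of_not_mem ha.2
    exact ⟨e, ha.1⟩
  refine ⟨c.onV (G.src d₀), {e | G.src (c.edge e) ∈ U}, fun e he => ?_, ?_, ?_, ?_⟩
  · have := hU _ (hne e) he
    rw [← src_inv, c.inv_edge] at this
    exact this
  -- Both sides contain surviving edges: walking from either end of the collapsed edge to a leaf of
  -- the forest reaches darts outside the forest.
  · obtain ⟨v, -, hv, -, -, -, hv2⟩ := c.isForest.exists_two c.isSubgraph_collapsed hG
      (c.isSubgraph_collapsed _ hd₀)
    obtain ⟨e, rfl⟩ := hdart v hv2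
    rw [inv_inv', tgt_inv] at hv
    refine ⟨e, JoinedIn.symm hsub (hv.mono ?_)⟩
    rintro a ⟨-, ha⟩
    exact ⟨trivial, by rwa [pair_comm]⟩
  · obtain ⟨v, -, hv, -, -, -, hv2⟩ := c.isForest.exists_two c.isSubgraph_collapsed hG hd₀
    obtain ⟨e, rfl⟩ := hdart v hv2
    refine ⟨e, fun he => htgt ((hv.mono ?_).trans he)⟩
    exact fun a ha => ⟨trivial, ha.2⟩
  · intro e he e' he' h
    rw [← c.src_edge] at h ⊢
    rw [← c.src_edge] at h
    exact hcross _ _ ((c.onV_eq_iff _ _).1 h) he he'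

/-- By connectedness some dart of `A` starts at the cut vertex. If it were the only one, its edge
would separate the rest of `A` from that vertex. -/
theorem two_le_ncard_of_cut {G : FinGraph} (hG : G.Connected) (hs : ¬ G.HasSeparatingEdge)
    {A : Set G.D} (hA : G.IsSubgraph A) (h1 : A.Nonempty) (h2 : Aᶜ.Nonempty) {v : G.V}
    (h : ∀ d ∈ A, ∀ d' ∉ A, G.src d = G.src d' → G.src d = v) :
    2 ≤ {d | G.src d = v ∧ d ∈ A}.ncard := by
  have hmem : ∀ d d', d ∈ A → G.src d = G.src d' → G.src d ≠ v → d' ∈ A := by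
    intro d d' hd hdd hne
    by_contra hd'
    exact hne (h d hd d' hd' hdd)
  have hne : {d | G.src d = v ∧ d ∈ A}.Nonempty := by
    by_contra hemp
    obtain ⟨d, hd⟩ := h1
    obtain ⟨d', hd'⟩ := h2
    have hA' : ∀ a ∈ A, G.src a ≠ v := fun a ha hav => hemp ⟨a, hav, ha⟩
    obtain ⟨b, hb, hbd⟩ := (hG.2 (G.src d) (G.src d')).mem_of_closed
      (S := {u | ∃ b ∈ A, G.src b = u}) (by
        rintro e - ⟨b, hb, hbe⟩
        exact ⟨_, hA _ (hmem b e hb hbe (hA' b hb)), rfl⟩) ⟨d, hd, rfl⟩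
    exact hd' (hmem b d' hb hbd (hA' b hb))
  obtain ⟨a, rfl, ha⟩ := hne
  by_contra hlt
  have hu : ∀ b, G.src b = G.src a → b ∈ A → b = a := fun b hb hbA =>
    (ncard_le_one (s := {d | G.src d = G.src a ∧ d ∈ A}) (toFinite _)).1 (by omega) b ⟨hb, hbA⟩ a
      ⟨rfl, ha⟩
  have hsep : G.JoinedIn (univ \ {a, G.inv a}) (G.src a) (G.tgt a) := by
    by_contra hsep
    exact hs ⟨a, hsep⟩
  have := (hsep.symm (isSubgraph_univ.diff_edge a)).mem_of_closed
    (S := {u | u ≠ G.src a ∧ ∃ b ∈ A, G.src b = u}) (by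
      rintro e he ⟨hea, b, hb, hbe⟩
      have heA := hmem b e hb hbe (hbe ▸ hea)
      refine ⟨fun ht => he.2 (Or.inr ?_), _, hA _ heA, rfl⟩
      have := hu (G.inv e) ht (hA _ heA)
      rw [← this, inv_inv']
      rfl) ⟨fun ht => ?_, _, hA _ ha, rfl⟩
  · exact this.1 rfl
  · exact G.inv_ne a (hu (G.inv a) ht (hA _ ha))

/-! ### Splitting a cut vertex -/

section Split

variable (G : FinGraph) {A : Set G.D} (v : G.V)

open Classical in
/-- The graph obtained from `G` by splitting the vertex `v` into two vertices that are joined by a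
new edge: the darts at `v` that are not in `A` are moved to the new vertex `none`. -/
def split (A : Set G.D) : FinGraph where
  V := Option G.V
  D := G.D ⊕ Bool
  src := Sum.elim (fun d => if G.src d = v ∧ d ∉ A then none else some (G.src d))
    (fun b => if b then some v else none)
  inv := Sum.map G.inv not
  inv_inv := by rintro (d | b) <;> simp
  inv_ne := by rintro (d | b) <;> simp [G.inv_ne]

theorem split_src_inl_of_mem {d : G.D} (hd : d ∈ A) :
    (G.split v A).src (Sum.inl d) = some (G.src d) := if_neg fun h => h.2 hd

theorem split_src_inl_of_ne {d : G.D} (hd : G.src d ≠ v) :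
    (G.split v A).src (Sum.inl d) = some (G.src d) := if_neg fun h => hd h.1

theorem split_src_inl_of_not_mem {d : G.D} (hd : d ∉ A) (hv : G.src d = v) :
    (G.split v A).src (Sum.inl d) = none := if_pos ⟨hv, hd⟩

theorem getD_split_src_inl (d : G.D) :
    ((G.split v A).src (Sum.inl d) : Option G.V).getD v = G.src d := by
  by_cases h : G.src d = v ∧ d ∉ A
  · rw [split_src_inl_of_not_mem G v h.2 h.1, ← h.1]
    rfl
  · rw [show (G.split v A).src (Sum.inl d) = some (G.src d) from if_neg h]
    rfl

theorem range_inl_compl : (range (Sum.inl : G.D → G.D ⊕ Bool))ᶜ = range Sum.inr := by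
  ext (d | b) <;> simp

/-- Collapsing the new edge. -/
def splitContraction (A : Set G.D) : Contraction (G.split v A) G where
  onV w := Option.getD w v
  edge := Sum.inl
  edge_injective := Sum.inl_injective
  inv_edge _ := rfl
  src_edge := G.getD_split_src_inl v
  onV_eq_iff u w := by
    have hr : range (Sum.inr : Bool → (G.split v A).D) = (range Sum.inl)ᶜ :=
      (range_inl_compl G).symm
    have h1 : (G.split v A).JoinedIn (range Sum.inr) (some v) none :=
      joinedIn_dart (G := G.split v A) (d := Sum.inr true) ⟨true, rfl⟩
    have h2 : (G.split v A).JoinedIn (range Sum.inr) none (some v) :=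
      joinedIn_dart (G := G.split v A) (d := Sum.inr false) ⟨false, rfl⟩
    refine Iff.trans ?_ (iff_of_eq (congrArg (fun B => (G.split v A).JoinedIn B u w) hr))
    constructor
    · rcases u with - | u <;> rcases w with - | w <;> intro h
      · exact JoinedIn.refl _ _
      · obtain rfl : v = w := h
        exact h2
      · obtain rfl : u = v := h
        exact h1
      · obtain rfl : u = w := h
        exact JoinedIn.refl _ _
    · intro h
      refine h.mem_of_closed (S := {w | Option.getD u v = Option.getD w v}) ?_ rfl
      rintro _ ⟨b, rfl⟩ hb
      refine Eq.trans hb ?_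
      cases b <;> rfl
  isForest := by
    have hr : range (Sum.inr : Bool → (G.split v A).D) = (range Sum.inl)ᶜ :=
      (range_inl_compl G).symm
    refine (congrArg (G.split v A).IsForest hr).mp ?_
    rintro _ ⟨b, rfl⟩ ⟨p, hp, hpA⟩
    cases p with
    | nil =>
      change (G.split v A).src (Sum.inr b) = (G.split v A).src (Sum.inr !b) at hp
      cases b <;> cases hp
    | cons d p =>
      obtain ⟨⟨b', rfl⟩, h⟩ := hpA d (by simp)
      refine h ?_
      cases b <;> cases b'
      exacts [Or.inl rfl, Or.inr rfl, Or.inr rfl, Or.inl rfl]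

variable {G v}

theorem three_le_valence_split (hG : ∀ v, 3 ≤ G.valence v)
    (h1 : 2 ≤ {d | G.src d = v ∧ d ∈ A}.ncard) (h2 : 2 ≤ {d | G.src d = v ∧ d ∉ A}.ncard)
    (w : (G.split v A).V) : 3 ≤ (G.split v A).valence w := by
  have key : ∀ (S : Set G.D) (b : Bool) (w : (G.split v A).V), 2 ≤ S.ncard →
      (∀ d ∈ S, (G.split v A).src (Sum.inl d) = w) → (G.split v A).src (Sum.inr b) = w →
      3 ≤ (G.split v A).valence w := by
    intro S b w hS hSw hb
    have hsub : insert (Sum.inr b : (G.split v A).D) (Sum.inl '' S) ⊆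
        {d | (G.split v A).src d = w} := by
      rintro _ (rfl | ⟨d, hd, rfl⟩)
      exacts [hb, hSw d hd]
    have := ncard_le_ncard hsub (toFinite _)
    rw [ncard_insert_of_notMem (by simp) (toFinite _),
      ncard_image_of_injective _ Sum.inl_injective] at this
    exact (by omega : 3 ≤ S.ncard + 1).trans this
  rcases w with - | w
  · exact key _ false _ h2 (fun d hd => split_src_inl_of_not_mem G v hd.2 hd.1) rfl
  by_cases hw : w = v
  · subst hw
    refine key _ true _ h1 (fun d hd => ?_) rfl
    rw [split_src_inl_of_mem G w hd.2, hd.1]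
  · have hsub : (Sum.inl '' {d | G.src d = w} : Set (G.split v A).D) ⊆
        {d | (G.split v A).src d = some w} := by
      rintro _ ⟨d, rfl, rfl⟩
      exact split_src_inl_of_ne G v hw
    have := ncard_le_ncard hsub (toFinite _)
    exact (hG w).trans ((ncard_image_of_injective _ Sum.inl_injective).symm.trans_le this)

theorem isSeparatingIn_split (hA : G.IsSubgraph A)
    (h : ∀ d ∈ A, ∀ d' ∉ A, G.src d = G.src d' → G.src d = v) (b : Bool) :
    (G.split v A).IsSeparatingIn univ (Sum.inr b) := by
  suffices ht : (G.split v A).IsSeparatingIn univ (Sum.inr true) by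
    cases b
    · exact (isSeparatingIn_inv (G := G.split v A) isSubgraph_univ (d := Sum.inr true)).2 ht
    · exact ht
  intro hj
  -- The set below consists of the vertices on the `A` side; without the new edge no path leaves it.
  have := hj.mem_of_closed
    (S := {w | w = some v ∨ ∃ a ∈ A, (G.split v A).src (Sum.inl a) = w}) ?_ (Or.inl rfl)
  · rcases this with h' | ⟨a, ha, h'⟩
    · cases h'
    · rw [split_src_inl_of_mem G v ha] at h'
      cases h'
  · rintro (d | b) hd hdS
    · refine Or.inr ⟨G.inv d, hA d ?_, rfl⟩
      by_contra hdA
      by_cases hdv : G.src d = v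
      · have h0 := split_src_inl_of_not_mem G v hdA hdv
        rcases hdS with h' | ⟨a, ha, h'⟩
        · cases h0.symm.trans h'
        · rw [split_src_inl_of_mem G v ha] at h'
          cases h0.symm.trans h'.symm
      · have h0 := split_src_inl_of_ne G (A := A) v hdv
        rcases hdS with h' | ⟨a, ha, h'⟩
        · exact hdv (Option.some.inj (h0.symm.trans h'))
        · rw [split_src_inl_of_mem G v ha] at h'
          have := Option.some.inj (h'.trans h0)
          exact hdv (this ▸ h a ha d hdA this)
    · refine (hd.2 ?_).elim
      cases b
      exacts [Or.inr rfl, Or.inl rfl]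

theorem core_split (hA : G.IsSubgraph A) (hs : ¬ G.HasSeparatingEdge)
    (h : ∀ d ∈ A, ∀ d' ∉ A, G.src d = G.src d' → G.src d = v) :
    (G.split v A).core = range Sum.inl := by
  ext (d | b)
  · have : d ∈ (G.splitContraction v A).edge ⁻¹' (G.split v A).core := by
      rw [Contraction.preimage_core, core_eq_univ_iff.2 hs]
      trivial
    exact iff_of_true this ⟨d, rfl⟩
  · exact iff_of_false (fun hb => hb (isSeparatingIn_split hA h b)) fun ⟨_, ha⟩ =>
      Sum.inl_ne_inr ha

end Split

end FinGraph

/-- A marked graph without separating edges that has a cut vertex is the result of collapsing a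
separating edge. -/
theorem MarkedGraph.exists_split {n : ℕ} (G : MarkedGraph n) (hs : ¬ G.HasSeparatingEdge)
    (hc : G.HasCutVertex) : ∃ (H : MarkedGraph n) (c : H.Collapse G),
      H.core = range c.edge ∧ H.coreᶜ.Nonempty := by
  obtain ⟨v, A, hA, hA1, hA2, h⟩ := hc
  have h1 := FinGraph.two_le_ncard_of_cut G.connected hs hA hA1 hA2 h
  have h2 := FinGraph.two_le_ncard_of_cut (v := v) G.connected hs hA.compl hA2
    (by rwa [compl_compl]) (fun d hd d' hd' hdd => by
      rw [hdd]
      exact h d' (not_not.1 hd') d hd hdd.symm)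
  let c := G.toFinGraph.splitContraction v A
  have hcol : ∀ d ∈ c.collapsed, ∃ b, Sum.inr b = d := fun d hd => by
    have : d ∈ (range (Sum.inl : G.D → G.D ⊕ Bool))ᶜ := hd
    rw [FinGraph.range_inl_compl] at this
    exact this
  let lab : (G.toFinGraph.split v A).D → F n := Sum.elim G.label fun _ => 1
  have h3 : ∀ e, G.label e = 1 * lab (c.edge e) * 1⁻¹ := fun e => by
    simp [lab, c, FinGraph.splitContraction]
  have h4 : ∀ d ∈ c.collapsed, 1 * lab d * 1⁻¹ = 1 := fun d hd => by
    obtain ⟨b, rfl⟩ := hcol d hd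
    simp [lab]
  have : Nonempty (G.toFinGraph.split v A).V := ⟨none⟩
  let H : MarkedGraph n :=
    { toFinGraph := G.toFinGraph.split v A
      connected := c.connected' G.connected
      three_le_valence := FinGraph.three_le_valence_split G.three_le_valence h1 h2
      label := lab
      label_inv := by
        rintro (d | b)
        · exact G.label_inv d
        · exact inv_one.symm
      marking := c.marking_of_target (γ := fun _ => 1) h3 h4 G.marking }
  have hcore : H.core = range (Sum.inl : G.D → G.D ⊕ Bool) := FinGraph.core_split hA hs h
  refine ⟨H, MarkedGraph.Collapse.ofContraction (G := H) c (fun _ => 1) h3 h4, hcore,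
    Sum.inr true, fun ht => ?_⟩
  rw [hcore] at ht
  obtain ⟨_, ha⟩ := ht
  exact Sum.inl_ne_inr ha

/-! ### Boundary points flowing to graphs with a cut vertex -/

namespace Point

variable {n : ℕ} (x : Point n) {H : MarkedGraph n} (c : H.Collapse x.graph)

/-- The point at which a point of Outer space degenerates when the length of the edges of its
maximal core subgraph is zero. -/
def degeneration (hx : x.depth = 0) (hc : H.core = range c.edge) (hH : H.coreᶜ.Nonempty) :
    Point n :=
  have hm : ∀ d, 0 ≤ H.coreᶜ.indicator (fun _ => (1 : ℝ)) d :=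
    indicator_nonneg fun _ _ => zero_le_one
  have hv : 0 < H.vol (H.coreᶜ.indicator fun _ => (1 : ℝ)) univ := by
    refine (FinGraph.vol_nonneg hm univ).lt_of_ne' fun h => ?_
    obtain ⟨d, hd⟩ := hH
    have := (FinGraph.vol_eq_zero_iff hm).1 h d trivial
    rw [indicator_of_mem hd] at this
    exact one_ne_zero this
  -- The first metric gives all separating edges the same length, normalized; any positive lengths
  -- would do, since the flow at time 1 forgets them.
  let m : ℕ → H.D → ℝ
    | 0 => fun d => (H.vol (H.coreᶜ.indicator fun _ => (1 : ℝ)) univ)⁻¹ *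
        H.coreᶜ.indicator (fun _ => (1 : ℝ)) d
    | 1 => Function.extend c.edge (x.m 0) 0
    | _ + 2 => 0
  have h0 : ∀ d, m 0 d = 0 ↔ d ∈ H.core := fun d => by
    simp only [m, mul_eq_zero, inv_eq_zero, hv.ne', false_or, indicator_apply_eq_zero,
      one_ne_zero, imp_false, mem_compl_iff, not_not]
  have h1 : ∀ d, m 1 d ≠ 0 ↔ d ∈ H.core := fun d => by
    by_cases hd : d ∈ range c.edge
    · rw [hc]
      refine iff_of_true ?_ hd
      obtain ⟨e, rfl⟩ := hd
      simp only [m, c.edge_injective.extend_apply]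
      obtain ⟨i, hi, -⟩ := x.nondegenerate e
      have := x.le_depth i e hi
      rwa [show i = 0 by omega] at hi
    · rw [hc]
      refine iff_of_false ?_ hd
      simp only [m, not_not]
      exact Function.extend_apply' _ _ _ hd
  have hsub := FinGraph.isSubgraph_core (G := H.toFinGraph)
  { graph := H
    depth := 1
    m := m
    m_nonneg := by
      rintro (_ | _ | i) d
      · exact mul_nonneg (inv_pos.2 hv).le (hm d)
      · have := ClosedCell.metric_nonneg (ClosedCell.pullback c (.self x)) 0 d
        rwa [ClosedCell.metric_pullback, ClosedCell.metric_self] at this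
      · exact le_rfl
    m_inv := by
      rintro (_ | _ | i) d
      · classical
        simp only [m, indicator_apply, hsub.compl.inv_mem_iff]
      · by_cases hd : d ∈ range c.edge
        · obtain ⟨e, rfl⟩ := hd
          rw [c.inv_edge]
          simp only [zero_add, m, c.edge_injective.extend_apply, x.m_inv]
        · rw [← hc] at hd
          rw [not_not.1 fun h => hd ((h1 d).1 h),
            not_not.1 fun h => hd (hsub.inv_mem_iff.1 ((h1 _).1 h))]
      · rfl
    nondegenerate := by
      intro d
      by_cases hd : d ∈ H.core
      · refine ⟨1, (h1 d).2 hd, ?_⟩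
        rintro (_ | _ | i) hi
        exacts [(hi ((h0 d).2 hd)).elim, rfl, (hi rfl).elim]
      · refine ⟨0, fun h => hd ((h0 d).1 h), ?_⟩
        rintro (_ | _ | i) hi
        exacts [rfl, (hd ((h1 d).1 hi)).elim, (hi rfl).elim]
    le_depth := by
      rintro (_ | _ | i) d hi
      exacts [zero_le_one, le_rfl, (hi rfl).elim]
    vol_eq_one := by
      intro i hi
      interval_cases i
      · rw [FinGraph.vol_const_mul, inv_mul_cancel₀ hv.ne']
      · refine (c.contraction.vol_extend (x.m 0) univ).trans ?_
        exact x.vol_eq_one 0 (Nat.zero_le _)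
    isCore := by
      intro i hi hi1
      obtain rfl : i = 1 := by omega
      have : {d | ∀ j < 1, m j d = 0} = H.core := by
        ext d
        simp [h0]
      rw [this]
      exact FinGraph.isCore_core }

theorem flow_degeneration (hx : x.depth = 0) (hc : H.core = range c.edge)
    (hH : H.coreᶜ.Nonempty) : XHat.flow (XHat.mk (x.degeneration c hx hc hH), 1) = XHat.mk x := by
  let y := x.degeneration c hx hc hH
  let c' : y.graph.Collapse x.graph := c
  refine XHat.flow_mk (.self y) (ClosedCell.pullback c' (.self x)) 1 ?_
  have hm1 : y.m 1 = Function.extend c'.edge (x.m 0) 0 := rfl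
  have hl : y.graph.coreLevel y.m = 1 := by
    refine le_antisymm y.coreLevel_le_one (Nat.one_le_iff_ne_zero.2 fun h => ?_)
    have hv := y.vol_coreLevel_ne_zero
    rw [h] at hv
    refine hv ((FinGraph.vol_eq_zero_iff (y.m_nonneg 0)).2 fun d hd => ?_)
    change _ * H.coreᶜ.indicator (fun _ => (1 : ℝ)) d = 0
    have hd' : (d : H.D) ∉ H.coreᶜ := not_not.2 hd
    exact mul_eq_zero_of_right _ (indicator_of_notMem hd' _)
  have hind : y.graph.core.indicator (y.m 1) = y.m 1 := by
    refine indicator_eq_self.2 fun d hd => ?_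
    change d ∈ H.core
    rw [hc]
    by_contra hdr
    exact hd (Function.extend_apply' _ _ _ hdr)
  have hvol : y.graph.vol (y.m 1) y.graph.core = 1 := by
    rw [← FinGraph.vol_indicator_univ, hind, y.vol_eq_one 1 le_rfl]
  rw [ClosedCell.metric_self]
  funext i
  rw [ClosedCell.metric_pullback, ClosedCell.metric_self]
  cases i with
  | zero =>
    funext d
    simp only [FinGraph.flow, hl, hind, hvol]
    simp [hm1]
  | succ i =>
    have h1 : x.m (i + 1) = 0 := by
      funext d
      by_contra h
      have := x.le_depth _ d h
      omega
    have h2 : y.graph.flow y.m ((1 : unitInterval) : ℝ) (i + 1) = 0 := by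
      simp only [FinGraph.flow, FinGraph.shift, hl]
      rw [if_neg (by simp)]
      rfl
    rw [h1, h2]
    funext d
    by_cases hd : d ∈ range c'.edge
    · obtain ⟨e, rfl⟩ := hd
      rw [c'.edge_injective.extend_apply]
      rfl
    · rw [Function.extend_apply' _ _ _ hd]

end Point

/-! ### The image of the boundary -/

namespace XHat

variable {n : ℕ}

theorem flow_mem_of_mem_boundary {z : XHat n} (hz : z ∈ boundaryXHat n) :
    flow (z, 1) ∈ boundaryYHat n ∪ cutVertexGraphs n := by
  obtain ⟨x, rfl⟩ : ∃ x, mk x = z := Quotient.exists_rep z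
  have hx : x.depth ≠ 0 := fun h => hz (mk_mem_X.2 h)
  have hY := (isEquivariantDeformationRetraction_flow n).map_one (mk x)
  have hflow : flow (mk x, 1) = mk (x.flow 1).1 := rfl
  by_cases hd : (x.flow 1).1.depth = 0
  · right
    have hs : x.graph.shift x.m ((1 : unitInterval) : ℝ) = x.graph.coreLevel x.m :=
      if_neg (by simp)
    have h1 := x.depth_flow 1
    have h2 := x.coreLevel_le_one
    rw [hs, hd] at h1
    -- The depth of `x` is positive, and the flow lowers it by the core level, which is at most one;
    -- to reach depth zero the level must be exactly one.
    have hl : x.graph.coreLevel x.m = 1 := by omega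
    have hv : x.graph.vol (x.m 0) univ ≠ 0 := by
      rw [x.vol_eq_one 0 (Nat.zero_le _)]
      exact one_ne_zero
    rw [Ne, FinGraph.vol_eq_zero_iff (x.m_nonneg 0)] at hv
    push Not at hv
    obtain ⟨d, -, hd0⟩ := hv
    have hdc : d ∉ x.graph.core := fun h =>
      hd0 (x.eq_zero_of_lt_coreLevel (by omega) h)
    rw [hflow, YHat_eq] at hY
    refine ⟨_, rfl, hd, mk_mem_noSeparatingEdge.1 hY, ?_⟩
    refine (x.flow 1).2.contraction.hasCutVertex x.graph.three_le_valence (d₀ := d) ?_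
      (not_not.1 hdc)
    intro hr
    have : d ∈ range (x.flow 1).2.edge := hr
    rw [ClosedCell.range_edge, Point.metric_flow] at this
    obtain ⟨i, hi⟩ := this
    refine hi ?_
    cases i with
    | zero => simp [FinGraph.flow, hdc]
    | succ i => exact x.eq_zero_of_ne hd0 (by omega)
  · left
    refine ⟨hY, ?_⟩
    rintro ⟨y, hy, hy0, -⟩
    exact hd (mk_mem_X.1 ⟨y, hy, hy0⟩)

theorem image_boundary (n : ℕ) : (fun z => flow (z, 1)) '' boundaryXHat n =
    boundaryYHat n ∪ cutVertexGraphs n := by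
  refine Subset.antisymm (image_subset_iff.2 fun z hz => flow_mem_of_mem_boundary hz) ?_
  rintro z (⟨hz, hzY⟩ | ⟨x, rfl, hx, hs, hc⟩)
  -- A point of the closure of Y_n that lies in Outer space has no separating edge, so it is in Y_n;
  -- the points outside Y_n are thus boundary points, fixed by the flow.
  · refine ⟨z, fun hX => hzY ?_, (isEquivariantDeformationRetraction_flow n).fixes z hz 1⟩
    obtain ⟨x, rfl, hx⟩ := hX
    rw [YHat_eq] at hz
    exact ⟨x, rfl, hx, mk_mem_noSeparatingEdge.1 hz⟩
  · obtain ⟨H, c, hcore, hne⟩ := x.graph.exists_split hs hc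
    refine ⟨_, fun h => ?_, x.flow_degeneration c hx hcore hne⟩
    exact one_ne_zero (mk_mem_X.1 h)

end XHat

end OuterSpace

end

theorem mainTheorem2 (n : ℕ) (hn : 2 ≤ n) :
    ∃ φ : OuterSpace.XHat n × unitInterval → OuterSpace.XHat n,
      OuterSpace.IsEquivariantDeformationRetraction (OuterSpace.Out n) (OuterSpace.YHat n) φ ∧
      (fun z => φ (z, 1)) '' OuterSpace.boundaryXHat n =
        OuterSpace.boundaryYHat n ∪ OuterSpace.cutVertexGraphs n :=
  ⟨OuterSpace.XHat.flow, OuterSpace.XHat.isEquivariantDeformationRetraction_flow n,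
    OuterSpace.XHat.image_boundary n⟩
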